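/- Let $d\ge 1$ and $0<\omega<1$. Let $U\in H^1(\mathbb{R}^d)$ be a complex-valued solution, in the sense of distributions, of $$-\Delta U+\omega U=\frac{|U|^2U}{1+|U|^2}\quad\text{in }\mathbb{R}^d$$ (that is, $A(x,t)=e^{i\omega t}U(x)$ is an $H^1$ solitary wave of the saturated nonlinear Schrödinger equation $i\partial_tA+\Delta A=-a\,\frac{|A|^2A}{1+|A|^2}$ with $a=1$). Then $$U\in H^\infty(\mathbb{R}^d)=\bigcap_{s\in\mathbb{R}}H^s(\mathbb{R}^d),$$ and $$e^{\delta|x|}\,U\in L^\infty(\mathbb{R}^d)\quad\text{for every real }\delta<\omega/2 .$$ -/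

import Mathlib

open MeasureTheory TemperedDistribution
open scoped ENNReal SchwartzMap Laplacian

noncomputable section

/-- The saturated cubic nonlinearity `z ↦ |z|² z / (1 + |z|²)` on `ℂ`. -/
def saturatedNonlinearity (z : ℂ) : ℂ :=
  (‖z‖ ^ 2 / (1 + ‖z‖ ^ 2)) • z

theorem continuous_saturatedNonlinearity : Continuous saturatedNonlinearity := by
  unfold saturatedNonlinearity
  have h : Continuous fun z : ℂ => ‖z‖ ^ 2 / (1 + ‖z‖ ^ 2) :=
    Continuous.div (by fun_prop) (by fun_prop) fun z => by positivity
  exact h.smul continuous_id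

theorem norm_saturatedNonlinearity_le (z : ℂ) : ‖saturatedNonlinearity z‖ ≤ ‖z‖ := by
  have h : ‖z‖ ^ 2 / (1 + ‖z‖ ^ 2) ≤ 1 := by
    rw [div_le_one (by positivity)]
    linarith
  rw [saturatedNonlinearity, norm_smul, Real.norm_of_nonneg (by positivity)]
  exact mul_le_of_le_one_left (norm_nonneg z) h

/-- The nonlinearity maps `L²` to `L²`. -/
theorem memLp_saturatedNonlinearity {d : ℕ}
    (U : Lp ℂ 2 (volume : Measure (EuclideanSpace ℝ (Fin d)))) :
    MemLp (fun x => saturatedNonlinearity (U x)) 2 volume :=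
  (Lp.memLp U).of_le
    (continuous_saturatedNonlinearity.comp_aestronglyMeasurable (Lp.aestronglyMeasurable U))
    (Filter.Eventually.of_forall fun x => norm_saturatedNonlinearity_le (U x))

/-- `|U|² U / (1 + |U|²)` as an element of `L²(ℝᵈ; ℂ)`, for `U ∈ L²(ℝᵈ; ℂ)`. -/
def saturatedTerm {d : ℕ} (U : Lp ℂ 2 (volume : Measure (EuclideanSpace ℝ (Fin d)))) :
    Lp ℂ 2 (volume : Measure (EuclideanSpace ℝ (Fin d))) :=
  (memLp_saturatedNonlinearity U).toLp

/-- `H¹` solitary waves of the saturated NLS equation `i ∂ₜA + ΔA = -a |A|² A / (1 + |A|²)`, i.e.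
profiles `U ∈ H¹(ℝᵈ; ℂ)` of waves `A(x, t) = exp(iωt) U(x)`: the elliptic equation
`-ΔU + ω U = a |U|² U / (1 + |U|²)` holds in the sense of (tempered) distributions. -/
structure IsSolitaryWave {d : ℕ} (a ω : ℝ)
    (U : Lp ℂ 2 (volume : Measure (EuclideanSpace ℝ (Fin d)))) : Prop where
  memSobolev_one : MemSobolev 1 2 (U : 𝓢'(EuclideanSpace ℝ (Fin d), ℂ))
  equation : -Δ (U : 𝓢'(EuclideanSpace ℝ (Fin d), ℂ))
      + (ω : ℂ) • (U : 𝓢'(EuclideanSpace ℝ (Fin d), ℂ))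
    = (a : ℂ) • (saturatedTerm U : 𝓢'(EuclideanSpace ℝ (Fin d), ℂ))

/-- `H^∞(ℝᵈ)`: the intersection of all the Sobolev spaces `Hˢ(ℝᵈ) = W^{s,2}(ℝᵈ)`. -/
def MemHInfty {d : ℕ} (f : 𝓢'(EuclideanSpace ℝ (Fin d), ℂ)) : Prop :=
  ∀ s : ℝ, MemSobolev s 2 f

end

/-! ### Maximum principle and interior gradient bound for the Laplacian. -/

section MaximumPrinciple

open Filter Topology

/-! The equation is rewritten as `U = (1 - (2π)⁻² Δ)⁻¹ g` with `g = F(U) U`, where `F` is smooth and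
bounded; the Bessel potential of order `-2` is this inverse. Everything then rests on the maximum
principle, which says that the inverse preserves nonnegativity and pointwise domination and does not
increase sup norms.

Boundedness of `U`: since `|g| ≤ C |U|`, domination can be iterated. `|U|` lies below the real part
of the `n`-fold image of `|U|` under `C (1 - (2π)⁻² Δ)⁻¹`, which is in `H^{2n}` and hence bounded
for large `n` (`ae_bound_of_norm_le_mul`).

Smoothness: the spaces `W^{k,2} ∩ W^{k,∞}` are stable under `(u, w) ↦ F(u) w`
(`BddSobolev.comp_mul`), and the inverse gains one derivative in them
(`BddSobolev.of_eq_besselPotential`), the sup norm of the gradient being controlled by a reflection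
and barrier argument (`abs_fderiv_le_of_abs_laplacian_le`). Bootstrapping from `k = 0` gives every
`Hˢ`.

Decay: `U` now has a `C²` representative `f` vanishing at infinity with `Δf = W f` and `W → ω`.
Comparing `|f|` with the exponentials `exp(-δ⟨e, x⟩)`, uniformly over unit vectors `e`, gives decay
at each rate `δ > 0` with `δ² < ω` (`exists_exp_mul_norm_le`). This includes all positive `δ < ω/2`
because `ω < 1`. -/

theorem IsLocalMax.deriv_deriv_nonpos {g : ℝ → ℝ} {a : ℝ} (hmax : IsLocalMax g a)
    (hg : ContinuousAt g a) : deriv (deriv g) a ≤ 0 := by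
  by_contra! h
  -- A positive second derivative would make `a` a local minimum as well, so `g` would be locally
  -- constant.
  have hmin : IsLocalMin g a := isLocalMin_of_deriv_deriv_pos h hmax.deriv_eq_zero hg
  have hconst : g =ᶠ[𝓝 a] fun _ => g a := by
    filter_upwards [hmax, hmin] with x h1 h2 using le_antisymm h1 h2
  have h2 : deriv (deriv g) a = 0 := by
    rw [hconst.deriv.deriv_eq]
    simp
  exact h.ne' h2

variable {E : Type*} [NormedAddCommGroup E] [InnerProductSpace ℝ E]

theorem ContDiff.hasDerivAt_comp_line {F : Type*} [NormedAddCommGroup F] [NormedSpace ℝ F]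
    {u : E → F} (hu : ContDiff ℝ 1 u) (x v : E) (t : ℝ) :
    HasDerivAt (fun t : ℝ => u (x + t • v)) (fderiv ℝ u (x + t • v) v) t := by
  have h1 : HasFDerivAt u (fderiv ℝ u (x + t • v)) (x + t • v) :=
    (hu.differentiable one_ne_zero _).hasFDerivAt
  have h2 : HasDerivAt (fun t : ℝ => x + t • v) v t := by
    simpa using ((hasDerivAt_id t).smul_const v).const_add x
  exact h1.comp_hasDerivAt t h2

theorem ContDiff.deriv_deriv_comp_line {F : Type*} [NormedAddCommGroup F] [NormedSpace ℝ F]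
    {u : E → F} (hu : ContDiff ℝ 2 u) (x v : E) (t : ℝ) :
    deriv (deriv fun t : ℝ => u (x + t • v)) t = iteratedFDeriv ℝ 2 u (x + t • v) ![v, v] := by
  have h1 : (deriv fun t : ℝ => u (x + t • v)) = fun t => fderiv ℝ u (x + t • v) v :=
    funext fun t => ((hu.of_le one_le_two).hasDerivAt_comp_line x v t).deriv
  rw [h1, iteratedFDeriv_two_apply]
  have h2 : ContDiff ℝ 1 (fderiv ℝ u) := hu.fderiv_right (by norm_num)
  have h3 := (h2.hasDerivAt_comp_line x v t).clm_apply (hasDerivAt_const t v)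
  simpa using h3.deriv

variable [FiniteDimensional ℝ E]

/-- The Laplacian is nonpositive at a local maximum. -/
theorem IsLocalMax.laplacian_nonpos {u : E → ℝ} {x : E} (hmax : IsLocalMax u x)
    (hu : ContDiff ℝ 2 u) : Δ u x ≤ 0 := by
  rw [InnerProductSpace.laplacian_eq_iteratedFDeriv_stdOrthonormalBasis]
  refine Finset.sum_nonpos fun i _ => ?_
  set v := stdOrthonormalBasis ℝ E i
  have hc : Continuous fun t : ℝ => x + t • v := by fun_prop
  have hx : x + (0 : ℝ) • v = x := by simp
  have h1 : IsLocalMax (fun t : ℝ => u (x + t • v)) 0 := by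
    have := (hc.tendsto 0).eventually (by rw [hx]; exact hmax)
    simpa [IsLocalMax, IsMaxFilter] using this
  have h2 := h1.deriv_deriv_nonpos ((hu.continuous.comp hc).continuousAt)
  rwa [hu.deriv_deriv_comp_line, hx] at h2


theorem exists_isMaxOn_of_eventually_cocompact {X : Type*} [TopologicalSpace X] {u : X → ℝ}
    {s : Set X} (hs : IsClosed s) (hu : Continuous u) {x₀ : X} (hx₀ : x₀ ∈ s)
    (hlim : ∀ᶠ x in cocompact X ⊓ 𝓟 s, u x ≤ u x₀) :
    ∃ x ∈ s, u x₀ ≤ u x ∧ ∀ y ∈ s, u y ≤ u x := by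
  obtain ⟨x, hxs, hx⟩ := hu.continuousOn.exists_isMaxOn' hs hx₀ hlim
  exact ⟨x, hxs, hx hx₀, fun y hy => hx hy⟩

/-- Weak maximum principle for `1 - k Δ` on functions vanishing at infinity. -/
theorem le_of_sub_laplacian_le {u : E → ℝ} (hu : ContDiff ℝ 2 u)
    (hlim : Tendsto u (cocompact E) (𝓝 0)) {k M : ℝ} (hk : 0 ≤ k) (hM : 0 ≤ M)
    (h : ∀ x, u x - k * Δ u x ≤ M) (x : E) : u x ≤ M := by
  by_contra! hx
  obtain ⟨y, -, hxy, hy⟩ := exists_isMaxOn_of_eventually_cocompact isClosed_univ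
    hu.continuous (Set.mem_univ x)
    ((hlim.eventually_le_const (hM.trans_lt hx)).filter_mono inf_le_left)
  have hmax : IsLocalMax u y := Eventually.of_forall fun z => hy z (Set.mem_univ z)
  have h1 := hmax.laplacian_nonpos hu
  have h2 := h y
  nlinarith

/-- The Laplacian commutes with affine isometries. -/
theorem laplacian_comp_add_linearIsometryEquiv {F : Type*} [NormedAddCommGroup F] [NormedSpace ℝ F]
    {u : E → F} (hu : ContDiff ℝ 2 u) (L : E ≃ₗᵢ[ℝ] E) (b x : E) :
    Δ (fun y => u (b + L y)) x = Δ u (b + L x) := by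
  have hc : ContDiff ℝ 2 fun y => u (b + L y) := hu.comp (contDiff_const.add L.contDiff)
  rw [InnerProductSpace.laplacian_eq_iteratedFDeriv_stdOrthonormalBasis,
    InnerProductSpace.laplacian_eq_iteratedFDeriv_orthonormalBasis u
      ((stdOrthonormalBasis ℝ E).map L)]
  refine Finset.sum_congr rfl fun i _ => ?_
  have h1 := hc.deriv_deriv_comp_line x (stdOrthonormalBasis ℝ E i) 0
  have h2 := hu.deriv_deriv_comp_line (b + L x) (L (stdOrthonormalBasis ℝ E i)) 0
  simp only [zero_smul, add_zero] at h1 h2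
  rw [OrthonormalBasis.map_apply, ← h1, ← h2]
  congr 2
  ext t
  simp [add_assoc]

/-- The Laplacian of a ridge function. -/
theorem laplacian_comp_inner {g : ℝ → ℝ} (hg : ContDiff ℝ 2 g) (e x : E) :
    Δ (fun y => g (inner ℝ e y)) x = ‖e‖ ^ 2 * deriv (deriv g) (inner ℝ e x) := by
  have hc : ContDiff ℝ 2 fun y : E => g (inner ℝ e y) :=
    hg.comp (contDiff_const.inner ℝ contDiff_id)
  -- Parseval expands `‖e‖²` so that the two sides can be matched one basis direction at a time.
  rw [InnerProductSpace.laplacian_eq_iteratedFDeriv_stdOrthonormalBasis,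
    ← (stdOrthonormalBasis ℝ E).sum_sq_inner_left e, Finset.sum_mul]
  refine Finset.sum_congr rfl fun i _ => ?_
  set v := stdOrthonormalBasis ℝ E i
  have h1 := hc.deriv_deriv_comp_line x v 0
  have h2 := hg.deriv_deriv_comp_line (inner ℝ e x) (inner ℝ e v) 0
  simp only [zero_smul, add_zero] at h1 h2
  simp only [← h1, inner_add_right, inner_smul_right, ← smul_eq_mul (a := (_ : ℝ))] at h2 ⊢
  rw [h2]
  have h3 := hg.deriv_deriv_comp_line (inner ℝ e x) 1 0
  simp only [zero_smul, add_zero] at h3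
  have h4 : (deriv fun t : ℝ => g (inner ℝ e x + t • (1 : ℝ)))
      = fun t => deriv g (inner ℝ e x + t) := by
    ext t
    simpa using deriv_comp_const_add g (inner ℝ e x) t
  rw [h4, deriv_comp_const_add (deriv g) (inner ℝ e x) 0, add_zero] at h3
  rw [h3]
  have h5 : (![inner ℝ e v, inner ℝ e v] : Fin 2 → ℝ) = fun i => inner ℝ e v • (![1, 1] : Fin 2 → ℝ) i := by
    ext i; fin_cases i <;> simp
  rw [h5, ContinuousMultilinearMap.map_smul_univ]
  simp [sq]

theorem HasDerivAt.nonpos_of_nonpos_right {h : ℝ → ℝ} {h' : ℝ} (hh : HasDerivAt h h' 0)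
    (h0 : h 0 = 0) (hle : ∀ t, 0 < t → t < 1 → h t ≤ 0) : h' ≤ 0 := by
  refine le_of_tendsto hh.tendsto_slope_zero_right ?_
  filter_upwards [Ioo_mem_nhdsGT (zero_lt_one (α := ℝ))] with t ht
  have h1 := hle t ht.1 ht.2
  have h2 : 0 < t⁻¹ := inv_pos.mpr ht.1
  simp only [zero_add, h0, sub_zero, smul_eq_mul]
  exact mul_nonpos_of_nonneg_of_nonpos h2.le h1

/-- Odd differences of a function vanishing at infinity are controlled by a quadratic barrier. -/
theorem sub_le_of_abs_laplacian_lt {u : E → ℝ} (hu : ContDiff ℝ 2 u)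
    (hlim : Tendsto u (cocompact E) (𝓝 0)) {A M : ℝ} (hM : ∀ x, |u x| ≤ M)
    (hA : ∀ x, |Δ u x| < A) (hMA : 2 * M ≤ A) {e : E} (he : ‖e‖ = 1) (x₀ : E) {t : ℝ}
    (ht0 : 0 < t) (ht1 : t < 1) :
    u (x₀ + t • e) - u (x₀ - t • e) ≤ A * (t * (2 - t)) := by
  -- `S` reflects in the hyperplane through `x₀` orthogonal to `e`, and `σ` is the signed distance
  -- to it. The barrier `B = -A σ (2 - σ)` has Laplacian `2A`, which outweighs `Δu - Δ(u ∘ S) >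
  -- -2A`. Hence `Δw > 0`, and `w` has no local maximum inside the slab `0 < σ < 1`.
  set L := Submodule.reflection (ℝ ∙ e)ᗮ with hL
  set S : E → E := fun y => (x₀ - L x₀) + L y with hS
  set σ : E → ℝ := fun y => inner ℝ e y - inner ℝ e x₀ with hσ
  set g : ℝ → ℝ := fun r => -(A * ((r - inner ℝ e x₀) * (2 - (r - inner ℝ e x₀)))) with hg
  have hgc : ContDiff ℝ 2 g := by fun_prop
  set B : E → ℝ := fun y => g (inner ℝ e y) with hB
  set w : E → ℝ := fun y => u y - u (S y) + B y with hw
  have hSc : ContDiff ℝ 2 fun y => u (S y) := hu.comp (contDiff_const.add L.contDiff)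
  have hBc : ContDiff ℝ 2 B := hgc.comp (contDiff_const.inner ℝ contDiff_id)
  have hwc : ContDiff ℝ 2 w := (hu.sub hSc).add hBc
  have hA0 : 0 < A := (abs_nonneg _).trans_lt (hA 0)
  have hinner : inner ℝ e e = (1 : ℝ) := by rw [real_inner_self_eq_norm_sq, he, one_pow]
  have hLe : ∀ y, L y = y - (2 * inner ℝ e y) • e := by
    intro y
    rw [hL, Submodule.reflection_orthogonal_apply, Submodule.reflection_singleton_apply]
    simp [he, mul_smul, two_smul]
  have hgdd : ∀ r, deriv (deriv g) r = 2 * A := by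
    intro r
    have h1 : deriv g = fun r => -(A * (2 - 2 * (r - inner ℝ e x₀))) := by
      ext r
      have hd : HasDerivAt (fun r : ℝ => r - inner ℝ e x₀) 1 r := (hasDerivAt_id r).sub_const _
      have : deriv g r = _ := ((hd.mul (hd.const_sub 2)).const_mul A).neg.deriv
      rw [this]
      ring
    rw [h1]
    have hd : HasDerivAt (fun r : ℝ => r - inner ℝ e x₀) 1 r := (hasDerivAt_id r).sub_const _
    refine (((hd.const_mul 2).const_sub 2).const_mul A).neg.deriv.trans ?_
    ring
  have hlap : ∀ y, Δ w y = Δ u y - Δ u (S y) + 2 * A := by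
    intro y
    have h1 : Δ w y = Δ (u - fun y => u (S y)) y + Δ B y :=
      (hu.sub hSc).contDiffAt.laplacian_add hBc.contDiffAt
    rw [h1, hu.contDiffAt.laplacian_sub hSc.contDiffAt,
      laplacian_comp_add_linearIsometryEquiv hu, laplacian_comp_inner hgc, hgdd, he]
    ring
  have hBs : ∀ y, B y = -(A * (σ y * (2 - σ y))) := fun y => rfl
  have hlimS : Tendsto (fun y => u (S y)) (cocompact E) (𝓝 0) := by
    have hiso : Topology.IsClosedEmbedding S :=
      (Homeomorph.addLeft (x₀ - L x₀)).isClosedEmbedding.comp L.toHomeomorph.isClosedEmbedding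
    exact hlim.comp hiso.tendsto_cocompact
  have hlimd : Tendsto (fun y => u y - u (S y)) (cocompact E) (𝓝 0) := by
    simpa using hlim.sub hlimS
  by_contra! hcon
  set s : Set E := {y | 0 ≤ σ y ∧ σ y ≤ 1} with hs
  have hσc : Continuous σ := by fun_prop
  have hsclosed : IsClosed s :=
    (isClosed_le continuous_const hσc).inter (isClosed_le hσc continuous_const)
  have hσt : σ (x₀ + t • e) = t := by simp [hσ, inner_add_right, inner_smul_right, he]
  have hSt : S (x₀ + t • e) = x₀ - t • e := by
    simp only [hS, hLe, inner_add_right, inner_smul_right, hinner]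
    module
  have hwpos : 0 < w (x₀ + t • e) := by
    simp only [hw, hBs, hσt, hSt]
    linarith
  obtain ⟨y, hys, hwy, hy⟩ := exists_isMaxOn_of_eventually_cocompact hsclosed hwc.continuous
    (x₀ := x₀ + t • e) (by exact ⟨hσt.symm ▸ ht0.le, hσt.symm ▸ ht1.le⟩)
    (by
      rw [eventually_inf_principal]
      filter_upwards [hlimd.eventually_le_const hwpos] with z hz hzs
      have : 0 ≤ A * (σ z * (2 - σ z)) :=
        mul_nonneg hA0.le (mul_nonneg hzs.1 (by linarith [hzs.2]))
      calc w z = u z - u (S z) + -(A * (σ z * (2 - σ z))) := rfl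
        _ ≤ _ := by linarith)
  have hwy0 : 0 < w y := hwpos.trans_le hwy
  -- The face `σ = 0` is fixed by `S`, so `w` vanishes there. On `σ = 1` the barrier equals `-A ≤
  -- -2M`, so `w ≤ 0`. A positive maximum is therefore interior.
  have h0 : σ y ≠ 0 := by
    intro h0
    have hSy : S y = y := by
      have h2 : inner ℝ e y = inner ℝ e x₀ := sub_eq_zero.mp h0
      simp only [hS, hLe, h2]
      module
    have : w y = 0 := by simp [hw, hBs, h0, hSy]
    exact hwy0.ne' this
  have h1 : σ y ≠ 1 := by
    intro h1
    have h2 := abs_le.mp (hM y)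
    have h3 := abs_le.mp (hM (S y))
    have : w y = u y - u (S y) + -(A * (1 * (2 - 1))) := by simp only [hw, hBs, h1]
    linarith
  have hmax : IsLocalMax w y := by
    have ho : IsOpen {z | 0 < σ z ∧ σ z < 1} :=
      (isOpen_lt continuous_const hσc).inter (isOpen_lt hσc continuous_const)
    filter_upwards [ho.mem_nhds ⟨lt_of_le_of_ne hys.1 h0.symm, lt_of_le_of_ne hys.2 h1⟩] with z hz
    exact hy z ⟨hz.1.le, hz.2.le⟩
  have h4 := hmax.laplacian_nonpos hwc
  rw [hlap] at h4
  have h5 := abs_lt.mp (hA y)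
  have h6 := abs_lt.mp (hA (S y))
  linarith

/-- Interior gradient bound: a function vanishing at infinity, bounded by `M` and with Laplacian
bounded by `N`, has directional derivatives bounded by `2 M + N`. -/
theorem abs_fderiv_le_of_abs_laplacian_le {u : E → ℝ} (hu : ContDiff ℝ 2 u)
    (hlim : Tendsto u (cocompact E) (𝓝 0)) {M N : ℝ} (hM : ∀ x, |u x| ≤ M)
    (hN : ∀ x, |Δ u x| ≤ N) {e : E} (he : ‖e‖ = 1) (x : E) :
    |fderiv ℝ u x e| ≤ 2 * M + N := by
  have hM0 : 0 ≤ M := (abs_nonneg _).trans (hM 0)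
  have hN0 : 0 ≤ N := (abs_nonneg _).trans (hN 0)
  have key : ∀ e : E, ‖e‖ = 1 → fderiv ℝ u x e ≤ 2 * M + N := by
    intro e he
    refine le_of_forall_pos_le_add fun η hη => ?_
    set A := 2 * M + N + η with hA
    have hline := (hu.of_le one_le_two).hasDerivAt_comp_line x e 0
    have hline' := (hu.of_le one_le_two).hasDerivAt_comp_line x (-e) 0
    simp only [zero_smul, add_zero, map_neg] at hline hline'
    -- The barrier `A t (2 - t)` is at most `2 A t` and tangent to it at `0`; the derivative at `0`
    -- of the odd difference is twice the directional derivative, so the factors `2` cancel.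
    have hd := (hline.sub hline').sub ((hasDerivAt_id (0 : ℝ)).const_mul (2 * A))
    have := hd.nonpos_of_nonpos_right (by simp) fun t ht0 ht1 => by
      have := sub_le_of_abs_laplacian_lt hu hlim hM (A := A)
        (fun y => (hN y).trans_lt (by linarith)) (by linarith) he x ht0 ht1
      have hA0 : 0 ≤ A := by positivity
      simp only [id, smul_neg, ← sub_eq_add_neg, Pi.sub_apply]
      nlinarith [mul_nonneg hA0 (sq_nonneg t)]
    linarith
  rw [abs_le]
  constructor
  · have := key (-e) (by simpa using he)
    rw [map_neg] at this
    linarith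
  · exact key e he

end MaximumPrinciple

/-! ### Bessel potentials as Fourier multipliers on `L²` and on Schwartz functions. -/

section FourierMultiplier

set_option linter.unusedSectionVars false

open FourierTransform LineDeriv Real

variable {E : Type*} [NormedAddCommGroup E] [InnerProductSpace ℝ E] [FiniteDimensional ℝ E]
  [MeasurableSpace E] [BorelSpace E]

theorem toTemperedDistribution_injective :
    Function.Injective fun f : Lp ℂ 2 (volume : Measure E) => (f : 𝓢'(E, ℂ)) :=
  LinearMap.ker_eq_bot.mp (Lp.ker_toTemperedDistributionCLM_eq_bot (F := ℂ) (μ := volume) (p := 2))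

/-- A Fourier multiplier with bounded symbol acts continuously on `L²`. -/
theorem exists_fourierMultiplier_L2 {m : E → ℂ} (hm : m.HasTemperateGrowth)
    (hb : ∃ C, ∀ x, ‖m x‖ ≤ C) :
    ∃ A : Lp ℂ 2 (volume : Measure E) →L[ℂ] Lp ℂ 2 (volume : Measure E),
      (∀ g, ((A g : Lp ℂ 2 (volume : Measure E)) : 𝓢'(E, ℂ))
        = TemperedDistribution.fourierMultiplierCLM ℂ m (g : 𝓢'(E, ℂ))) ∧
      ∀ φ : 𝓢(E, ℂ), A (φ.toLp 2) = (SchwartzMap.fourierMultiplierCLM ℂ m φ).toLp 2 := by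
  obtain ⟨C, hC⟩ := hb
  have hmem : MemLp m ∞ (volume : Measure E) :=
    memLp_top_of_bound hm.1.continuous.aestronglyMeasurable C (Filter.Eventually.of_forall hC)
  set M : Lp ℂ 2 (volume : Measure E) →L[ℂ] Lp ℂ 2 (volume : Measure E) :=
    (ContinuousLinearMap.lsmul ℂ ℂ (E := ℂ)).holderL volume ∞ 2 2 hmem.toLp with hM
  set A := (Lp.fourierTransformₗᵢ E ℂ).symm.toContinuousLinearEquiv.toContinuousLinearMap ∘L M ∘L
    (Lp.fourierTransformₗᵢ E ℂ).toContinuousLinearEquiv.toContinuousLinearMap with hA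
  have hApply : ∀ g, A g = 𝓕⁻ (hmem.toLp • (𝓕 g) : Lp ℂ 2 (volume : Measure E)) := fun g => rfl
  have h1 : ∀ g, ((A g : Lp ℂ 2 (volume : Measure E)) : 𝓢'(E, ℂ))
        = TemperedDistribution.fourierMultiplierCLM ℂ m (g : 𝓢'(E, ℂ)) := by
    intro g
    rw [hApply, ← Lp.fourierInv_toTemperedDistribution_eq, Lp.toTemperedDistribution_smul_eq hm,
      ← Lp.fourier_toTemperedDistribution_eq, TemperedDistribution.fourierMultiplierCLM_apply]
  refine ⟨A, h1, fun φ => toTemperedDistribution_injective ?_⟩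
  simp only [h1, Lp.toTemperedDistribution_toLp_eq]
  exact fourierMultiplierCLM_toTemperedDistributionCLM_eq hm φ

/-- The Bessel potential `(1 - (2π)⁻² Δ) ^ (s / 2)` on Schwartz functions. -/
noncomputable def besselSchwartz (s : ℝ) : 𝓢(E, ℂ) →L[ℂ] 𝓢(E, ℂ) :=
  SchwartzMap.fourierMultiplierCLM ℂ fun x => (((1 + ‖x‖ ^ 2) ^ (s / 2) : ℝ) : ℂ)

theorem norm_besselSymbol_le {s : ℝ} (hs : s ≤ 0) (x : E) :
    ‖(((1 + ‖x‖ ^ 2) ^ (s / 2) : ℝ) : ℂ)‖ ≤ 1 := by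
  rw [Complex.norm_real, Real.norm_eq_abs, abs_of_nonneg (by positivity)]
  exact Real.rpow_le_one_of_one_le_of_nonpos (by simp) (by linarith)

/-- Decay of order `-1` absorbs the single factor `|x|` of a first derivative; this is where the
threshold `s ≤ -1` comes from. -/
theorem norm_inner_mul_besselSymbol_le {s : ℝ} (hs : s ≤ -1) (m x : E) :
    ‖((inner ℝ x m * (1 + ‖x‖ ^ 2) ^ (s / 2) : ℝ) : ℂ)‖ ≤ ‖m‖ := by
  have h1 : (1 + ‖x‖ ^ 2) ^ (s / 2) ≤ (√(1 + ‖x‖ ^ 2))⁻¹ := by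
    rw [Real.sqrt_eq_rpow, ← Real.rpow_neg (by positivity)]
    exact Real.rpow_le_rpow_of_exponent_le (by simp) (by linarith)
  have h2 : ‖x‖ ≤ √(1 + ‖x‖ ^ 2) := Real.le_sqrt_of_sq_le (by linarith)
  have h3 : 0 < √(1 + ‖x‖ ^ 2) := by positivity
  rw [Complex.norm_real, norm_mul, Real.norm_of_nonneg (by positivity : 0 ≤ (1 + ‖x‖ ^ 2) ^ (s / 2))]
  calc ‖(inner ℝ x m : ℝ)‖ * (1 + ‖x‖ ^ 2) ^ (s / 2)
      ≤ (√(1 + ‖x‖ ^ 2) * ‖m‖) * (√(1 + ‖x‖ ^ 2))⁻¹ := by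
        gcongr
        exact (norm_inner_le_norm x m).trans (by gcongr)
    _ = ‖m‖ := by field_simp

/-- Bessel potentials of order at most `-1` and their first derivatives act continuously
on `L²`. -/
theorem exists_bessel_L2 {s : ℝ} (hs : s ≤ -1) (m : E) :
    ∃ A D : Lp ℂ 2 (volume : Measure E) →L[ℂ] Lp ℂ 2 (volume : Measure E),
      (∀ g, ((A g : Lp ℂ 2 (volume : Measure E)) : 𝓢'(E, ℂ))
        = besselPotential E ℂ s (g : 𝓢'(E, ℂ))) ∧
      (∀ g, ((D g : Lp ℂ 2 (volume : Measure E)) : 𝓢'(E, ℂ))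
        = ∂_{m} (besselPotential E ℂ s (g : 𝓢'(E, ℂ)))) ∧
      (∀ φ : 𝓢(E, ℂ), A (φ.toLp 2) = (besselSchwartz s φ).toLp 2) ∧
      ∀ φ : 𝓢(E, ℂ), D (φ.toLp 2) = (∂_{m} (besselSchwartz s φ)).toLp 2 := by
  obtain ⟨A, hA, hA'⟩ := exists_fourierMultiplier_L2
    (m := fun x : E => (((1 + ‖x‖ ^ 2) ^ (s / 2) : ℝ) : ℂ)) (by fun_prop)
    ⟨1, norm_besselSymbol_le (by linarith)⟩
  obtain ⟨D, hD, hD'⟩ := exists_fourierMultiplier_L2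
    (m := fun x : E => ((inner ℝ x m * (1 + ‖x‖ ^ 2) ^ (s / 2) : ℝ) : ℂ)) (by fun_prop)
    ⟨‖m‖, norm_inner_mul_besselSymbol_le hs m⟩
  have hsplit : ∀ g, (((2 * π * Complex.I : ℂ) • D g : Lp ℂ 2 (volume : Measure E)) : 𝓢'(E, ℂ))
        = ∂_{m} (besselPotential E ℂ s (g : 𝓢'(E, ℂ))) := by
    intro g
    rw [← Lp.toTemperedDistributionCLM_apply, map_smul, Lp.toTemperedDistributionCLM_apply, hD,
      TemperedDistribution.lineDeriv_eq_fourierMultiplierCLM, besselPotential,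
      TemperedDistribution.fourierMultiplierCLM_fourierMultiplierCLM_apply (by fun_prop)
        (by fun_prop)]
    congr 3
    ext x
    simp [mul_comm]
  refine ⟨A, (2 * π * Complex.I : ℂ) • D, hA, hsplit, hA', fun φ =>
    toTemperedDistribution_injective ?_⟩
  have h1 := hsplit (φ.toLp 2)
  simp only [smul_apply]
  simp only [h1, Lp.toTemperedDistribution_toLp_eq,
    ← TemperedDistribution.lineDerivOp_toTemperedDistributionCLM_eq]
  congr 1
  exact fourierMultiplierCLM_toTemperedDistributionCLM_eq (by fun_prop) φ

/-- The symbol is `1 + |ξ|²`, while `-Δ` has symbol `(2π)² |ξ|²` in this normalization of the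
Fourier transform. This is the origin of the factor `(2π)⁻²` throughout. -/
theorem besselPotential_two_eq (f : 𝓢'(E, ℂ)) :
    besselPotential E ℂ 2 f = f - (((2 * π) ^ 2)⁻¹ : ℝ) • Δ f := by
  rw [TemperedDistribution.laplacian_eq_fourierMultiplierCLM, smul_smul]
  have h0 : besselPotential E ℂ 2 = fourierMultiplierCLM ℂ (fun _ : E => (1 : ℂ))
      + fourierMultiplierCLM ℂ (fun x : E => Complex.ofReal (‖x‖ ^ 2)) := by
    have := fourierMultiplierCLM_sum ℂ (s := Finset.univ)
      (g := fun (i : Fin 2) (x : E) => if i = 0 then (1 : ℂ) else Complex.ofReal (‖x‖ ^ 2))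
      (by
        intro i _
        fin_cases i
        · exact Function.HasTemperateGrowth.const 1
        · exact (by fun_prop : Function.HasTemperateGrowth fun x : E => Complex.ofReal (‖x‖ ^ 2)))
    simp only [Fin.sum_univ_two] at this
    simp only [Fin.isValue, ↓reduceIte, one_ne_zero] at this
    rw [← this, besselPotential]
    congr
    ext x
    norm_num
  rw [h0]
  have hpi : ((2 * π) ^ 2)⁻¹ * -(2 * π) ^ 2 = -1 := by field_simp
  simp [hpi]

/-- The composition law for Bessel potentials holds on tempered distributions and descends because
Schwartz functions embed injectively. The result is a classical pointwise equation, to which the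
maximum principle applies. -/
theorem besselSchwartz_neg_two_sub_laplacian (φ : 𝓢(E, ℂ)) :
    besselSchwartz (-2) φ - (((2 * π) ^ 2)⁻¹ : ℝ) • Δ (besselSchwartz (-2) φ) = φ := by
  have hbS : ∀ (s : ℝ) (ψ : 𝓢(E, ℂ)), ((besselSchwartz s ψ : 𝓢(E, ℂ)) : 𝓢'(E, ℂ))
      = besselPotential E ℂ s (ψ : 𝓢'(E, ℂ)) := fun s ψ =>
    (fourierMultiplierCLM_toTemperedDistributionCLM_eq (by fun_prop) ψ).symm
  have hinj : Function.Injective fun ψ : 𝓢(E, ℂ) => (ψ : 𝓢'(E, ℂ)) := by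
    intro a b hab
    apply SchwartzMap.injective_toLp (2 : ℝ≥0∞) (volume : Measure E)
    apply toTemperedDistribution_injective
    simpa only [Lp.toTemperedDistribution_toLp_eq] using hab
  apply hinj
  have h1 := besselPotential_two_eq (besselPotential E ℂ (-2) (φ : 𝓢'(E, ℂ)))
  rw [besselPotential_besselPotential_apply] at h1
  simp only [neg_add_cancel, besselPotential_zero, ContinuousLinearMap.id_apply] at h1
  simp only [map_sub]
  rw [← Complex.coe_smul, map_smul, ← laplacian_toTemperedDistributionCLM_eq, hbS,
    Complex.coe_smul]
  exact h1.symm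

end FourierMultiplier

/-! ### Schwartz approximation in `L²` respecting pointwise constraints. -/

section LTwo

open Filter Topology

theorem Lp.tendsto_of_dominated {α : Type*} [MeasurableSpace α] {μ : Measure α}
    {f : ℕ → Lp ℂ 2 μ} {g : Lp ℂ 2 μ} {bound : α → ℝ} (hb : MemLp bound 2 μ)
    (hle : ∀ n, ∀ᵐ x ∂μ, ‖f n x - g x‖ ≤ bound x)
    (hlim : ∀ᵐ x ∂μ, Tendsto (fun n => f n x) atTop (𝓝 (g x))) :
    Tendsto f atTop (𝓝 g) := by
  rw [Lp.tendsto_Lp_iff_tendsto_eLpNorm']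
  have h2 : ∀ n, eLpNorm (⇑(f n) - ⇑g) 2 μ
      = (∫⁻ x, ‖f n x - g x‖ₑ ^ (2 : ℝ) ∂μ) ^ (1 / 2 : ℝ) := by
    intro n
    rw [eLpNorm_eq_lintegral_rpow_enorm_toReal (by norm_num) (by norm_num)]
    simp
  simp only [h2]
  have h3 : Tendsto (fun n => ∫⁻ x, ‖f n x - g x‖ₑ ^ (2 : ℝ) ∂μ) atTop (𝓝 (∫⁻ _, 0 ∂μ)) := by
    refine tendsto_lintegral_of_dominated_convergence' (fun x => ‖bound x‖ₑ ^ (2 : ℝ)) ?_ ?_ ?_ ?_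
    · intro n
      exact (((Lp.aestronglyMeasurable (f n)).sub (Lp.aestronglyMeasurable g)).enorm).pow_const _
    · intro n
      filter_upwards [hle n] with x hx
      gcongr
      rw [enorm_le_iff_norm_le]
      exact hx.trans (Real.le_norm_self _)
    · have := (eLpNorm_lt_top_iff_lintegral_rpow_enorm_lt_top (by norm_num) (by norm_num)).mp hb.2
      simpa using this.ne
    · filter_upwards [hlim] with x hx
      have h4 : Tendsto (fun n => ‖f n x - g x‖ₑ) atTop (𝓝 ‖g x - g x‖ₑ) :=
        ((hx.sub_const _).enorm)
      have h5 := (ENNReal.continuous_rpow_const (y := 2)).continuousAt.tendsto.comp h4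
      simpa [Function.comp_def] using h5
  have h6 := (ENNReal.continuous_rpow_const (y := 1 / 2)).continuousAt.tendsto.comp h3
  simpa [Function.comp_def] using h6

/-- An `L²`-convergent sequence has an almost everywhere convergent subsequence. This transfers
pointwise bounds from Schwartz functions to their limits. -/
theorem Lp.isClosed_ae_mem {α : Type*} [MeasurableSpace α] {μ : Measure α} {S : Set ℂ}
    (hS : IsClosed S) : IsClosed {f : Lp ℂ 2 μ | ∀ᵐ x ∂μ, f x ∈ S} := by
  refine IsSeqClosed.isClosed fun f g hf hfg => ?_
  obtain ⟨ns, -, hns⟩ := (tendstoInMeasure_of_tendsto_Lp hfg).exists_seq_tendsto_ae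
  have h := ae_all_iff.mpr fun n => hf (ns n)
  filter_upwards [hns, h] with x hx hxn
  exact hS.mem_of_tendsto hx (Eventually.of_forall hxn)

variable {E : Type*} [NormedAddCommGroup E] [InnerProductSpace ℝ E] [FiniteDimensional ℝ E]
  [MeasurableSpace E] [BorelSpace E]

/-- If `N` is smooth, Lipschitz and fixes `0`, then `N ∘ g` is an `L²` limit of
Schwartz functions with values in the range of `N`. -/
theorem compLp_mem_closure {N : ℂ → ℂ} {c : NNReal} (hN : LipschitzWith c N) (h0 : N 0 = 0)
    (hs : ContDiff ℝ (⊤ : ℕ∞) N) (g : Lp ℂ 2 (volume : Measure E)) :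
    hN.compLp h0 g ∈ closure
      {f : Lp ℂ 2 (volume : Measure E) | ∃ φ : 𝓢(E, ℂ), (∀ x, φ x ∈ Set.range N) ∧ φ.toLp 2 = f} := by
  refine map_mem_closure (s := {f : Lp ℂ 2 (volume : Measure E) |
    ∃ ψ : E → ℂ, HasCompactSupport ψ ∧ ContDiff ℝ (⊤ : ℕ∞) ψ ∧ f =ᵐ[volume] ψ})
    (hN.continuous_compLp h0) ?_ ?_
  · refine (mem_closure_iff_nhds_basis Metric.nhds_basis_closedBall).2 fun ε hε => ?_
    obtain ⟨ψ, h1, h2, h3⟩ := MemLp.exist_eLpNorm_sub_le (by norm_num) (by norm_num)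
      (Lp.memLp g) hε
    refine ⟨(h1.toSchwartzMap h2).toLp 2, ⟨ψ, h1, h2, (h1.toSchwartzMap h2).coeFn_toLp 2 _⟩, ?_⟩
    have : (g : E → ℂ) - ((h1.toSchwartzMap h2).toLp 2 : E → ℂ) =ᵐ[volume] (g : E → ℂ) - ψ := by
      filter_upwards [(h1.toSchwartzMap h2).coeFn_toLp 2 volume]
      simp
    rw [Metric.mem_closedBall', Lp.dist_def, eLpNorm_congr_ae this]
    exact ENNReal.toReal_le_of_le_ofReal hε.le h3
  · rintro f ⟨ψ, h1, h2, h3⟩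
    have h4 : HasCompactSupport (N ∘ ψ) := h1.comp_left h0
    refine ⟨h4.toSchwartzMap (hs.comp h2), fun x => ⟨ψ x, rfl⟩, ?_⟩
    ext1
    filter_upwards [(h4.toSchwartzMap (hs.comp h2)).coeFn_toLp 2 volume, hN.coeFn_compLp h0 f, h3]
      with x hx hx' hx''
    rw [hx, hx', Function.comp_apply, hx'']
    rfl

/-- An `L²` function bounded by `M` is an `L²` limit of Schwartz functions bounded by `M + 1`. -/
theorem mem_closure_schwartz_of_norm_le {g : Lp ℂ 2 (volume : Measure E)} {M : ℝ} (hM : 0 < M)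
    (hg : ∀ᵐ x, ‖g x‖ ≤ M) :
    g ∈ closure {f : Lp ℂ 2 (volume : Measure E) |
      ∃ φ : 𝓢(E, ℂ), (∀ x, ‖φ x‖ ≤ M + 1) ∧ φ.toLp 2 = f} := by
  -- The truncation `b(z) z` is the identity on the ball of radius `M`, so it fixes `g`, and it
  -- vanishes outside radius `M + 1`, so its values have norm at most `M + 1`.
  let b : ContDiffBump (0 : ℂ) := ⟨M, M + 1, hM, by linarith⟩
  set N : ℂ → ℂ := fun z => b z • z with hNdef
  have hs : ContDiff ℝ (⊤ : ℕ∞) N := b.contDiff.smul contDiff_id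
  have hcomp : HasCompactSupport N := b.hasCompactSupport.smul_right
  obtain ⟨c, hN⟩ := hs.lipschitzWith_of_hasCompactSupport hcomp (by simp)
  have h0 : N 0 = 0 := by simp [hNdef]
  have hgN : hN.compLp h0 g = g := by
    ext1
    filter_upwards [hN.coeFn_compLp h0 g, hg] with x hx hx'
    rw [hx]
    simp only [Function.comp_apply, hNdef]
    rw [b.one_of_mem_closedBall (by simpa using hx'), one_smul]
  have := compLp_mem_closure hN h0 hs g
  rw [hgN] at this
  refine closure_mono ?_ this
  rintro f ⟨φ, h1, h2⟩
  refine ⟨φ, fun x => ?_, h2⟩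
  obtain ⟨z, hz⟩ := h1 x
  rw [← hz, hNdef, norm_smul, Real.norm_of_nonneg b.nonneg]
  by_cases hzM : ‖z‖ ≤ M + 1
  · exact (mul_le_of_le_one_left (norm_nonneg z) b.le_one).trans hzM
  · rw [b.zero_of_le_dist (by simpa using (not_le.mp hzM).le), zero_mul]
    linarith

/-- Each root is the modulus of `x + iε`, so this is the reverse triangle inequality. -/
theorem Real.abs_sqrt_sq_add_sq_sub_le {ε : ℝ} (x y : ℝ) :
    |√(x ^ 2 + ε ^ 2) - √(y ^ 2 + ε ^ 2)| ≤ |x - y| := by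
  have h1 : ∀ x : ℝ, √(x ^ 2 + ε ^ 2) = ‖(⟨x, ε⟩ : ℂ)‖ := by
    intro x
    rw [Complex.norm_def, Complex.normSq_mk, sq, sq]
  rw [h1, h1]
  refine (abs_norm_sub_norm_le _ _).trans ?_
  rw [Complex.norm_def, Complex.normSq_apply]
  simp [Real.sqrt_mul_self_eq_abs]

/-- An `L²` function with nonnegative real part is an `L²` limit of Schwartz functions with
nonnegative real part. -/
theorem mem_closure_schwartz_of_re_nonneg {g : Lp ℂ 2 (volume : Measure E)}
    (hg : ∀ᵐ x, 0 ≤ (g x).re) :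
    g ∈ closure {f : Lp ℂ 2 (volume : Measure E) |
      ∃ φ : 𝓢(E, ℂ), (∀ x, 0 ≤ (φ x).re) ∧ φ.toLp 2 = f} := by
  -- With `ε = 1/(n+1)`, the real part is replaced by `√(re² + ε²) - ε` and the imaginary part is
  -- kept. This is smooth, fixes `0`, has nonnegative real part, and is within `ε` of the identity
  -- where `re ≥ 0`.
  set N : ℕ → ℂ → ℂ := fun n z =>
    z + ((√(z.re ^ 2 + (1 / ((n : ℝ) + 1)) ^ 2) - 1 / ((n : ℝ) + 1) - z.re : ℝ) : ℂ) with hNdef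
  have hre : ∀ n z, (N n z).re = √(z.re ^ 2 + (1 / ((n : ℝ) + 1)) ^ 2) - 1 / ((n : ℝ) + 1) := by
    intro n z
    simp only [hNdef, Complex.add_re, Complex.ofReal_re]
    ring
  have h0 : ∀ n, N n 0 = 0 := by
    intro n
    have : √((1 / ((n : ℝ) + 1)) ^ 2) = 1 / ((n : ℝ) + 1) := Real.sqrt_sq (by positivity)
    simp only [hNdef, Complex.zero_re]
    rw [show (0 : ℝ) ^ 2 + (1 / ((n : ℝ) + 1)) ^ 2 = (1 / ((n : ℝ) + 1)) ^ 2 by ring, this]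
    simp
  have hs : ∀ n, ContDiff ℝ (⊤ : ℕ∞) (N n) := by
    intro n
    have h1 : ContDiff ℝ (⊤ : ℕ∞) fun z : ℂ => z.re := Complex.reCLM.contDiff
    have h2 : ContDiff ℝ (⊤ : ℕ∞) fun z : ℂ => √(z.re ^ 2 + (1 / ((n : ℝ) + 1)) ^ 2) :=
      ((h1.pow 2).add contDiff_const).sqrt fun z => by positivity
    exact contDiff_id.add (Complex.ofRealCLM.contDiff.comp ((h2.sub contDiff_const).sub h1))
  -- `N n` is the identity plus two `1`-Lipschitz terms, up to constants and sign.
  have hL : ∀ n, LipschitzWith 3 (N n) := by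
    intro n
    refine LipschitzWith.of_dist_le_mul fun z w => ?_
    rw [dist_eq_norm, dist_eq_norm]
    have h1 : N n z - N n w = (z - w) + (((√(z.re ^ 2 + (1 / ((n : ℝ) + 1)) ^ 2)
        - √(w.re ^ 2 + (1 / ((n : ℝ) + 1)) ^ 2) : ℝ) : ℂ) - ((z - w).re : ℝ)) := by
      simp only [hNdef, Complex.sub_re]
      push_cast
      ring
    rw [h1]
    have h2 : ‖(((√(z.re ^ 2 + (1 / ((n : ℝ) + 1)) ^ 2)
        - √(w.re ^ 2 + (1 / ((n : ℝ) + 1)) ^ 2) : ℝ) : ℂ))‖ ≤ ‖z - w‖ := by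
      rw [Complex.norm_real, Real.norm_eq_abs]
      refine (Real.abs_sqrt_sq_add_sq_sub_le _ _).trans ?_
      rw [← Complex.sub_re]
      exact Complex.abs_re_le_norm _
    have h3 : ‖(((z - w).re : ℝ) : ℂ)‖ ≤ ‖z - w‖ := by
      rw [Complex.norm_real, Real.norm_eq_abs]
      exact Complex.abs_re_le_norm _
    have h4 := norm_add_le (z - w) (((√(z.re ^ 2 + (1 / ((n : ℝ) + 1)) ^ 2)
        - √(w.re ^ 2 + (1 / ((n : ℝ) + 1)) ^ 2) : ℝ) : ℂ) - ((z - w).re : ℝ))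
    have h5 := norm_sub_le (((√(z.re ^ 2 + (1 / ((n : ℝ) + 1)) ^ 2)
        - √(w.re ^ 2 + (1 / ((n : ℝ) + 1)) ^ 2) : ℝ) : ℂ)) (((z - w).re : ℝ) : ℂ)
    have h6 : ((3 : NNReal) : ℝ) = 3 := rfl
    rw [h6]
    linarith
  have hbd : ∀ n z, 0 ≤ z.re → ‖N n z - z‖ ≤ z.re ∧ ‖N n z - z‖ ≤ 1 / ((n : ℝ) + 1) := by
    intro n z hz
    set ε : ℝ := 1 / ((n : ℝ) + 1)
    have hε : 0 ≤ ε := by positivity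
    have h1 : N n z - z = ((√(z.re ^ 2 + ε ^ 2) - ε - z.re : ℝ) : ℂ) := by
      simp only [hNdef, add_sub_cancel_left]
      rfl
    have h2 : z.re ≤ √(z.re ^ 2 + ε ^ 2) := Real.le_sqrt_of_sq_le (by nlinarith)
    have h3 : ε ≤ √(z.re ^ 2 + ε ^ 2) := Real.le_sqrt_of_sq_le (by nlinarith)
    have h4 : √(z.re ^ 2 + ε ^ 2) ≤ z.re + ε := Real.sqrt_le_iff.mpr ⟨by positivity, by nlinarith⟩
    rw [h1, Complex.norm_real, Real.norm_eq_abs]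
    constructor <;> rw [abs_le] <;> constructor <;> linarith
  have hmem : ∀ n, (hL n).compLp (h0 n) g ∈ closure {f : Lp ℂ 2 (volume : Measure E) |
      ∃ φ : 𝓢(E, ℂ), (∀ x, 0 ≤ (φ x).re) ∧ φ.toLp 2 = f} := by
    intro n
    refine closure_mono ?_ (compLp_mem_closure (hL n) (h0 n) (hs n) g)
    rintro f ⟨φ, h1, h2⟩
    refine ⟨φ, fun x => ?_, h2⟩
    obtain ⟨z, hz⟩ := h1 x
    rw [← hz, hre, sub_nonneg]
    exact Real.le_sqrt_of_sq_le (by nlinarith [sq_nonneg z.re])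
  have htend : Tendsto (fun n => (hL n).compLp (h0 n) g) atTop (𝓝 g) := by
    refine Lp.tendsto_of_dominated (bound := fun x => ‖g x‖) (Lp.memLp g).norm ?_ ?_
    · intro n
      filter_upwards [(hL n).coeFn_compLp (h0 n) g, hg] with x hx hx'
      rw [hx]
      exact (hbd n _ hx').1.trans ((le_abs_self _).trans (Complex.abs_re_le_norm _))
    · filter_upwards [ae_all_iff.mpr fun n => (hL n).coeFn_compLp (h0 n) g, hg] with x hx hx'
      rw [tendsto_iff_norm_sub_tendsto_zero]
      refine squeeze_zero (fun n => norm_nonneg _) (fun n => ?_)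
        (tendsto_one_div_add_atTop_nhds_zero_nat (𝕜 := ℝ))
      rw [hx n]
      exact (hbd n _ hx').2
  exact isClosed_closure.mem_of_tendsto htend (Eventually.of_forall hmem)

end LTwo

/-! ### Positivity, domination and sup bounds for `(1 - (2π)⁻² Δ)⁻¹`. -/

section Resolvent

set_option linter.unusedSectionVars false

open Filter Topology LineDeriv Real

variable {E : Type*} [NormedAddCommGroup E] [InnerProductSpace ℝ E] [FiniteDimensional ℝ E]
  [MeasurableSpace E] [BorelSpace E]

/-- The real part of a rotated Schwartz function. -/
theorem contDiff_re_mul_schwartz (ψ : 𝓢(E, ℂ)) (c : ℂ) :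
    ContDiff ℝ 2 fun x => (c * ψ x).re := by
  have h : ContDiff ℝ 2 ψ := ψ.smooth 2
  exact Complex.reCLM.contDiff.comp (contDiff_const.mul h)

theorem laplacian_re_mul {u : E → ℂ} (hu : ContDiff ℝ 2 u) (c : ℂ) (x : E) :
    Δ (fun x => (c * u x).re) x = (c * Δ u x).re :=
  hu.contDiffAt.laplacian_CLM_comp_left (x := x)
    (l := Complex.reCLM ∘L (ContinuousLinearMap.mul ℝ ℂ c))

theorem tendsto_re_mul {u : E → ℂ} (hu : Tendsto u (cocompact E) (𝓝 0)) (c : ℂ) :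
    Tendsto (fun x => (c * u x).re) (cocompact E) (𝓝 0) := by
  have h := (Complex.continuous_re.tendsto _).comp (hu.const_mul c)
  rw [mul_zero, Complex.zero_re] at h
  exact h

theorem besselSchwartz_neg_two_sub_laplacian_apply (φ : 𝓢(E, ℂ)) (c : ℂ) (x : E) :
    (c * besselSchwartz (-2) φ x).re
      - ((2 * π) ^ 2)⁻¹ * Δ (fun x => (c * besselSchwartz (-2) φ x).re) x = (c * φ x).re := by
  have h := DFunLike.congr_fun (besselSchwartz_neg_two_sub_laplacian φ) x
  rw [laplacian_re_mul ((besselSchwartz (-2) φ).smooth 2), ← SchwartzMap.laplacian_apply]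
  rw [← h]
  simp only [sub_apply, smul_apply, mul_sub, Complex.sub_re, Complex.real_smul]
  rw [mul_left_comm, Complex.re_ofReal_mul]

theorem re_besselSchwartz_le {φ : 𝓢(E, ℂ)} {c : ℂ} {M : ℝ} (hM : 0 ≤ M)
    (h : ∀ x, (c * φ x).re ≤ M) (x : E) : (c * besselSchwartz (-2) φ x).re ≤ M := by
  refine le_of_sub_laplacian_le (contDiff_re_mul_schwartz _ c)
    (tendsto_re_mul (SchwartzMap.tendsto_cocompact _) c) (k := ((2 * π) ^ 2)⁻¹) (by positivity) hM
    (fun y => ?_) x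
  rw [besselSchwartz_neg_two_sub_laplacian_apply]
  exact h y

/-- Some unimodular `c` rotates `z` onto the positive axis. This reduces modulus bounds for complex
functions to real-valued maximum principles. -/
theorem norm_le_of_forall_re_mul_le {z : ℂ} {M : ℝ} (h : ∀ c : ℂ, ‖c‖ = 1 → (c * z).re ≤ M) :
    ‖z‖ ≤ M := by
  obtain ⟨c, hc, hcz⟩ := RCLike.exists_norm_eq_mul_self z
  have := h c hc
  rw [← hcz] at this
  simpa using this

theorem re_mul_le_norm_of_norm_eq_one {c z : ℂ} (hc : ‖c‖ = 1) : |(c * z).re| ≤ ‖z‖ := by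
  refine (Complex.abs_re_le_norm _).trans ?_
  rw [norm_mul, hc, one_mul]

theorem norm_besselSchwartz_le {φ : 𝓢(E, ℂ)} {M : ℝ} (h : ∀ x, ‖φ x‖ ≤ M) (x : E) :
    ‖besselSchwartz (-2) φ x‖ ≤ M :=
  norm_le_of_forall_re_mul_le fun _ hc =>
    re_besselSchwartz_le ((norm_nonneg _).trans (h 0))
      (fun y => (le_abs_self _).trans ((re_mul_le_norm_of_norm_eq_one hc).trans (h y))) x

/-- Solving the equation for the Laplacian bounds it by `(2π)² · 2M`; the interior gradient bound
then applies to every rotated real part. -/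
theorem norm_lineDeriv_besselSchwartz_le {φ : 𝓢(E, ℂ)} {M : ℝ} (h : ∀ x, ‖φ x‖ ≤ M) {e : E}
    (he : ‖e‖ = 1) (x : E) :
    ‖(∂_{e} (besselSchwartz (-2) φ)) x‖ ≤ 2 * M + (2 * π) ^ 2 * (2 * M) := by
  refine norm_le_of_forall_re_mul_le fun c hc => ?_
  have hd : fderiv ℝ (fun x => (c * besselSchwartz (-2) φ x).re) x e
      = (c * (∂_{e} (besselSchwartz (-2) φ)) x).re := by
    rw [SchwartzMap.lineDerivOp_apply_eq_fderiv]
    have h1 := ((Complex.reCLM ∘L (ContinuousLinearMap.mul ℝ ℂ c)).hasFDerivAt).comp x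
      ((besselSchwartz (-2) φ).differentiableAt (x := x)).hasFDerivAt
    rw [show (fun x => (c * besselSchwartz (-2) φ x).re)
      = (Complex.reCLM ∘L (ContinuousLinearMap.mul ℝ ℂ c)) ∘ (besselSchwartz (-2) φ) from rfl,
      h1.fderiv]
    rfl
  rw [← hd]
  refine (le_abs_self _).trans (abs_fderiv_le_of_abs_laplacian_le (contDiff_re_mul_schwartz _ c)
    (tendsto_re_mul (SchwartzMap.tendsto_cocompact _) c)
    (fun y => (re_mul_le_norm_of_norm_eq_one hc).trans (norm_besselSchwartz_le h y))
    (fun y => ?_) he x)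
  have h1 := besselSchwartz_neg_two_sub_laplacian_apply φ c y
  have h2 := (re_mul_le_norm_of_norm_eq_one (z := besselSchwartz (-2) φ y) hc).trans
    (norm_besselSchwartz_le h y)
  have h3 := (re_mul_le_norm_of_norm_eq_one (z := φ y) hc).trans (h y)
  have hpi : 0 < (2 * π) ^ 2 := by positivity
  have h4 : Δ (fun x => (c * besselSchwartz (-2) φ x).re) y
      = (2 * π) ^ 2 * ((c * besselSchwartz (-2) φ y).re - (c * φ y).re) := by
    rw [← h1]
    field_simp
    ring
  rw [h4, abs_mul, abs_of_pos hpi]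
  gcongr
  refine (abs_sub _ _).trans ?_
  linarith

variable {u g k : Lp ℂ 2 (volume : Measure E)}

/-- `(1 - (2π)⁻² Δ)⁻¹` preserves nonnegativity of the real part. -/
theorem re_nonneg_of_eq_besselPotential
    (hu : (u : 𝓢'(E, ℂ)) = besselPotential E ℂ (-2) (g : 𝓢'(E, ℂ))) (hg : ∀ᵐ x, 0 ≤ (g x).re) :
    ∀ᵐ x, 0 ≤ (u x).re := by
  obtain ⟨A, -, hA, -, hA', -⟩ := exists_bessel_L2 (E := E) (s := -2) (by norm_num) 0
  have hAu : A g = u := toTemperedDistribution_injective (by simp only [hA, hu])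
  have hcl : IsClosed {f : Lp ℂ 2 (volume : Measure E) | ∀ᵐ x, f x ∈ {z : ℂ | 0 ≤ z.re}} :=
    Lp.isClosed_ae_mem (isClosed_le continuous_const Complex.continuous_re)
  have h1 := map_mem_closure A.continuous (mem_closure_schwartz_of_re_nonneg hg)
    (t := {f : Lp ℂ 2 (volume : Measure E) | ∀ᵐ x, f x ∈ {z : ℂ | 0 ≤ z.re}}) (by
      rintro f ⟨φ, h1, rfl⟩
      rw [hA']
      filter_upwards [(besselSchwartz (-2) φ).coeFn_toLp 2 volume] with x hx
      rw [hx]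
      have := re_besselSchwartz_le (c := -1) (M := 0) le_rfl (φ := φ)
        (fun y => by simpa using h1 y) x
      simpa using this)
  rw [hcl.closure_eq, hAu] at h1
  exact h1

/-- Domination is preserved by `(1 - (2π)⁻² Δ)⁻¹`. -/
theorem norm_le_re_of_eq_besselPotential {v : Lp ℂ 2 (volume : Measure E)}
    (hu : (u : 𝓢'(E, ℂ)) = besselPotential E ℂ (-2) (g : 𝓢'(E, ℂ)))
    (hv : (v : 𝓢'(E, ℂ)) = besselPotential E ℂ (-2) (k : 𝓢'(E, ℂ)))
    (hgk : ∀ᵐ x, ‖g x‖ ≤ (k x).re) : ∀ᵐ x, ‖u x‖ ≤ (v x).re := by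
  -- `|c| v - c u` is the potential of `|c| k - c g`, whose real part is nonnegative by domination.
  have key : ∀ c : ℂ, ∀ᵐ x, (c * u x).re ≤ ‖c‖ * (v x).re := by
    intro c
    have h1 : (((‖c‖ : ℂ) • v - c • u : Lp ℂ 2 (volume : Measure E)) : 𝓢'(E, ℂ))
        = besselPotential E ℂ (-2)
          (((‖c‖ : ℂ) • k - c • g : Lp ℂ 2 (volume : Measure E)) : 𝓢'(E, ℂ)) := by
      simp only [← Lp.toTemperedDistributionCLM_apply, map_sub, map_smul] at hu hv ⊢
      rw [hu, hv]
    have h2 := re_nonneg_of_eq_besselPotential h1 (by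
      filter_upwards [hgk, Lp.coeFn_sub ((‖c‖ : ℂ) • k) (c • g), Lp.coeFn_smul (‖c‖ : ℂ) k,
        Lp.coeFn_smul c g] with x hx h3 h4 h5
      rw [h3, Pi.sub_apply, h4, h5]
      simp only [Pi.smul_apply, smul_eq_mul, Complex.sub_re, Complex.re_ofReal_mul]
      have h6 := (Complex.re_le_norm (c * g x))
      rw [norm_mul] at h6
      nlinarith [norm_nonneg c])
    filter_upwards [h2, Lp.coeFn_sub ((‖c‖ : ℂ) • v) (c • u), Lp.coeFn_smul (‖c‖ : ℂ) v,
      Lp.coeFn_smul c u] with x hx h3 h4 h5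
    rw [h3, Pi.sub_apply, h4, h5] at hx
    simp only [Pi.smul_apply, smul_eq_mul, Complex.sub_re, Complex.re_ofReal_mul] at hx
    linarith
  -- The null set depends on `c`; a countable dense family of `c` gives a common one, and continuity
  -- in `c` recovers the rest.
  filter_upwards [ae_all_iff.mpr fun n => key (TopologicalSpace.denseSeq ℂ n)] with x hx
  have h1 : ∀ c : ℂ, (c * u x).re ≤ ‖c‖ * (v x).re := by
    have hcl : IsClosed {c : ℂ | (c * u x).re ≤ ‖c‖ * (v x).re} :=
      isClosed_le (by fun_prop) (by fun_prop)
    intro c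
    exact (TopologicalSpace.denseRange_denseSeq ℂ).induction_on c hcl hx
  exact norm_le_of_forall_re_mul_le fun c hc => by simpa [hc] using h1 c

theorem ae_bound_of_schwartz_bound (A : Lp ℂ 2 (volume : Measure E) →L[ℂ] Lp ℂ 2 (volume : Measure E))
    {M C : ℝ} (hM : 0 < M) (hg : ∀ᵐ x, ‖g x‖ ≤ M)
    (hA : ∀ φ : 𝓢(E, ℂ), (∀ x, ‖φ x‖ ≤ M + 1) → ∃ ψ : 𝓢(E, ℂ), A (φ.toLp 2) = ψ.toLp 2 ∧
      ∀ x, ‖ψ x‖ ≤ C) :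
    ∀ᵐ x, ‖A g x‖ ≤ C := by
  have hcl : IsClosed {f : Lp ℂ 2 (volume : Measure E) | ∀ᵐ x, f x ∈ {z : ℂ | ‖z‖ ≤ C}} :=
    Lp.isClosed_ae_mem (isClosed_le continuous_norm continuous_const)
  have h1 := map_mem_closure A.continuous (mem_closure_schwartz_of_norm_le hM hg)
    (t := {f : Lp ℂ 2 (volume : Measure E) | ∀ᵐ x, f x ∈ {z : ℂ | ‖z‖ ≤ C}}) (by
      rintro f ⟨φ, h1, rfl⟩
      obtain ⟨ψ, h2, h3⟩ := hA φ h1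
      rw [h2]
      filter_upwards [ψ.coeFn_toLp 2 volume] with x hx
      rw [hx]
      exact h3 x)
  rw [hcl.closure_eq] at h1
  exact h1

/-- `L^∞` bound: if `u - (2π)⁻² Δ u = g ∈ L² ∩ L^∞`, then `u ∈ L^∞`. -/
theorem ae_bound_of_eq_besselPotential
    (hu : (u : 𝓢'(E, ℂ)) = besselPotential E ℂ (-2) (g : 𝓢'(E, ℂ)))
    (hg : ∃ M, ∀ᵐ x, ‖g x‖ ≤ M) : ∃ M, ∀ᵐ x, ‖u x‖ ≤ M := by
  obtain ⟨M, hgM⟩ := hg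
  obtain ⟨A, -, hA, -, hA', -⟩ := exists_bessel_L2 (E := E) (s := -2) (by norm_num) 0
  have hAu : A g = u := toTemperedDistribution_injective (by simp only [hA, hu])
  rw [← hAu]
  exact ⟨_, ae_bound_of_schwartz_bound A (M := |M| + 1) (by positivity)
    (hgM.mono fun x hx => hx.trans (by linarith [le_abs_self M]))
    fun φ hφ => ⟨_, hA' φ, norm_besselSchwartz_le hφ⟩⟩

/-- `W^{1,∞}` bound: if `u - (2π)⁻² Δ u = g ∈ L² ∩ L^∞`, then the first derivatives of `u` are in
`L² ∩ L^∞`. -/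
theorem exists_lineDeriv_ae_bound_of_eq_besselPotential
    (hu : (u : 𝓢'(E, ℂ)) = besselPotential E ℂ (-2) (g : 𝓢'(E, ℂ)))
    (hg : ∃ M, ∀ᵐ x, ‖g x‖ ≤ M) {e : E} (he : ‖e‖ = 1) :
    ∃ v : Lp ℂ 2 (volume : Measure E), ∂_{e} (u : 𝓢'(E, ℂ)) = v ∧ ∃ M, ∀ᵐ x, ‖v x‖ ≤ M := by
  obtain ⟨M, hgM⟩ := hg
  obtain ⟨A, D, hA, hD, hA', hD'⟩ := exists_bessel_L2 (E := E) (s := -2) (by norm_num) e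
  refine ⟨D g, by rw [hD, hu], _, ae_bound_of_schwartz_bound D (M := |M| + 1) (by positivity)
    (hgM.mono fun x hx => hx.trans (by linarith [le_abs_self M]))
    fun φ hφ => ⟨_, hD' φ, norm_lineDeriv_besselSchwartz_le hφ he⟩⟩

end Resolvent

/-! ### Sobolev embedding in `C²` and boundedness by iterated domination. -/

section SobolevEmbedding

set_option linter.unusedSectionVars false

open Filter Topology FourierTransform

variable {E : Type*} [NormedAddCommGroup E] [InnerProductSpace ℝ E] [FiniteDimensional ℝ E]
  [MeasurableSpace E] [BorelSpace E]

theorem ae_eq_of_forall_schwartz_integral_eq {f g : E → ℂ} (hf : LocallyIntegrable f)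
    (hg : LocallyIntegrable g)
    (h : ∀ φ : 𝓢(E, ℂ), ∫ x, φ x • f x = ∫ x, φ x • g x) : f =ᵐ[volume] g := by
  refine ae_eq_of_integral_contDiff_smul_eq hf hg fun φ hφ hφc => ?_
  have hc : HasCompactSupport (Complex.ofRealCLM ∘ φ) := hφc.comp_left rfl
  have hs : ContDiff ℝ (⊤ : ℕ∞) (Complex.ofRealCLM ∘ φ) := by fun_prop
  simpa using h (hc.toSchwartzMap hs)

/-- Locally integrable functions equal as distributions are equal almost everywhere. Applied to
Fourier transforms, this converts two extra Sobolev derivatives into integrability of `(1 + |ξ|²)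
û`. -/
theorem Integrable.of_fourier_smul {v : Lp ℂ 1 (volume : Measure E)}
    {w : Lp ℂ 1 (volume : Measure E)} {m : E → ℂ} (hm : m.HasTemperateGrowth)
    (h : TemperedDistribution.smulLeftCLM ℂ m (v : 𝓢'(E, ℂ)) = w) :
    Integrable fun x => m x * v x := by
  have hv : Integrable v := memLp_one_iff_integrable.mp (Lp.memLp v)
  have hw : Integrable w := memLp_one_iff_integrable.mp (Lp.memLp w)
  refine hw.congr (ae_eq_of_forall_schwartz_integral_eq hw.locallyIntegrable ?_ fun φ => ?_)
  · exact (locallyIntegrable_iff).mpr fun K hK => by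
      simpa using! (hv.integrableOn (s := K)).continuousOn_mul hm.1.continuous.continuousOn hK
  · have h1 := DFunLike.congr_fun h φ
    rw [TemperedDistribution.smulLeftCLM_apply_apply] at h1
    simp only [Lp.toTemperedDistribution_apply, SchwartzMap.smulLeftCLM_apply_apply hm] at h1
    rw [← h1]
    congr 1
    ext x
    simp only [smul_eq_mul]
    ring

theorem integral_fourierInv_smul_eq_of_integrable {f g : E → ℂ} (hf : Integrable f)
    (hg : Integrable g) : ∫ x, 𝓕⁻ f x • g x = ∫ x, f x • 𝓕⁻ g x := by
  have h1 : ∫ x, 𝓕 (fun y => f (-y)) x • g x = ∫ x, f (-x) • 𝓕 g x := by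
    simpa using! VectorFourier.integral_fourierIntegral_smul_eq_flip (L := innerₗ E)
      Real.continuous_fourierChar continuous_inner hf.comp_neg hg
  rw [Real.fourierInv_eq_fourier_comp_neg, h1, ← integral_neg_eq_self]
  simp only [neg_neg, Real.fourierInv_eq_fourier_neg]

/-- Sobolev embedding of `H^{s+2}` in `C²` for `s > d / 2`. -/
theorem exists_contDiff_two_of_memSobolev {s : ℝ} (hs : Module.finrank ℝ E < 2 * s)
    {u : Lp ℂ 2 (volume : Measure E)} (hu : MemSobolev (s + 2) 2 (u : 𝓢'(E, ℂ))) :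
    ∃ f : E → ℂ, ContDiff ℝ 2 f ∧ Tendsto f (cocompact E) (𝓝 0) ∧ u =ᵐ[volume] f := by
  obtain ⟨v, hv⟩ := MemSobolev.fourier_memL1 hs (hu.mono (by linarith))
  obtain ⟨w, hw⟩ := MemSobolev.fourier_memL1 hs
    (f := besselPotential E ℂ 2 (u : 𝓢'(E, ℂ)))
    (memSobolev_besselPotential_iff.mpr (by rwa [add_comm]))
  rw [fourier_besselPotential_eq_smulLeftCLM_fourier_apply, hv] at hw
  have hvi : Integrable v := memLp_one_iff_integrable.mp (Lp.memLp v)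
  have hwi := Integrable.of_fourier_smul (by fun_prop) hw
  have hv2 : Integrable fun x : E => ‖x‖ ^ 2 * ‖v x‖ := by
    refine hwi.mono ((continuous_norm.pow 2).aestronglyMeasurable.mul
      hvi.aestronglyMeasurable.norm) (Eventually.of_forall fun x => ?_)
    have h1 : ((1 + ‖x‖ ^ 2) ^ ((2 : ℝ) / 2) : ℝ) = 1 + ‖x‖ ^ 2 := by norm_num
    rw [norm_mul, norm_mul, h1, Complex.norm_real, norm_norm,
      Real.norm_of_nonneg (by positivity), Real.norm_of_nonneg (by positivity)]
    gcongr
    linarith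
  have hv1 : Integrable fun x : E => ‖x‖ ^ 1 * ‖v x‖ := by
    refine (hvi.norm.add hv2).mono ((continuous_norm.pow 1).aestronglyMeasurable.mul
      hvi.aestronglyMeasurable.norm) (Eventually.of_forall fun x => ?_)
    simp only [Pi.add_apply, pow_one]
    rw [Real.norm_of_nonneg (by positivity), Real.norm_of_nonneg (by positivity)]
    nlinarith [norm_nonneg (v x), sq_nonneg (‖x‖ - 1)]
  have hC : ContDiff ℝ 2 (𝓕 (v : E → ℂ)) := by
    refine Real.contDiff_fourier (N := 2) fun n hn => ?_
    have hn' : n ≤ 2 := by exact_mod_cast hn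
    interval_cases n
    · simpa using hvi.norm
    · exact hv1
    · exact hv2
  have hinv : ∀ x, 𝓕⁻ (v : E → ℂ) x = 𝓕 (v : E → ℂ) (-x) := fun x =>
    Real.fourierInv_eq_fourier_neg _ _
  have hCinv : ContDiff ℝ 2 (𝓕⁻ (v : E → ℂ)) := by
    rw [funext hinv]
    exact hC.comp contDiff_neg
  refine ⟨𝓕⁻ (v : E → ℂ), hCinv, ?_, ?_⟩
  · rw [funext hinv]
    have h1 : Tendsto (𝓕 (v : E → ℂ)) (cocompact E) (𝓝 0) :=
      tendsto_integral_exp_inner_smul_cocompact (v : E → ℂ)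
    exact h1.comp (Homeomorph.neg E).isClosedEmbedding.tendsto_cocompact
  · refine ae_eq_of_forall_schwartz_integral_eq ((Lp.memLp u).locallyIntegrable (by norm_num))
      hCinv.continuous.locallyIntegrable fun φ => ?_
    have h1 : (u : 𝓢'(E, ℂ)) = 𝓕⁻ (v : 𝓢'(E, ℂ)) := by
      rw [← hv, fourierInv_fourier_eq]
    have h2 := DFunLike.congr_fun h1 φ
    rw [TemperedDistribution.fourierInv_apply, Lp.toTemperedDistribution_apply,
      Lp.toTemperedDistribution_apply] at h2
    rw [h2]
    rw [SchwartzMap.fourierInv_coe]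
    exact integral_fourierInv_smul_eq_of_integrable φ.integrable hvi

theorem exists_norm_le_of_tendsto_cocompact {f : E → ℂ} (hf : Continuous f)
    (hlim : Tendsto f (cocompact E) (𝓝 0)) : ∃ M, ∀ x, ‖f x‖ ≤ M := by
  let F : ZeroAtInftyContinuousMap E ℂ := ⟨⟨f, hf⟩, hlim⟩
  exact ⟨‖F.toBCF‖, fun x => F.toBCF.norm_coe_le_norm x⟩

/-- `L²` solutions of `u - (2π)⁻² Δ u = g` with `|g| ≤ C |u|` are bounded. -/
theorem ae_bound_of_norm_le_mul {u g : Lp ℂ 2 (volume : Measure E)} {C : ℝ}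
    (hu : (u : 𝓢'(E, ℂ)) = besselPotential E ℂ (-2) (g : 𝓢'(E, ℂ))) (hC : 0 ≤ C)
    (hg : ∀ᵐ x, ‖g x‖ ≤ C * ‖u x‖) : ∃ M, ∀ᵐ x, ‖u x‖ ≤ M := by
  obtain ⟨A, -, hA, -⟩ := exists_bessel_L2 (E := E) (s := -2) (by norm_num) 0
  -- The majorants start at `|u|` and continue with `k ↦ A (C k)`. Each step gains two Sobolev
  -- derivatives and keeps the domination, since `|g| ≤ C |u| ≤ C re k`.
  have key : ∀ n : ℕ, ∃ k : Lp ℂ 2 (volume : Measure E),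
      MemSobolev (2 * n) 2 (k : 𝓢'(E, ℂ)) ∧ ∀ᵐ x, ‖u x‖ ≤ (k x).re := by
    intro n
    induction n with
    | zero =>
      have h1 : MemLp (fun x => ((‖u x‖ : ℝ) : ℂ)) 2 (volume : Measure E) := (Lp.memLp u).norm.ofReal
      refine ⟨h1.toLp, by simp [MemSobolev], ?_⟩
      filter_upwards [h1.coeFn_toLp] with x hx
      rw [hx, Complex.ofReal_re]
    | succ n ih =>
      obtain ⟨k, hk, huk⟩ := ih
      refine ⟨A ((C : ℂ) • k), ?_, ?_⟩
      · rw [hA, memSobolev_besselPotential_iff, ← Lp.toTemperedDistributionCLM_apply, map_smul]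
        convert! hk.smul (C : ℂ) using 1
        push_cast
        ring
      · refine norm_le_re_of_eq_besselPotential hu (hA _) ?_
        filter_upwards [hg, huk, Lp.coeFn_smul (C : ℂ) k] with x h1 h2 h3
        rw [h3, Pi.smul_apply, smul_eq_mul, Complex.re_ofReal_mul]
        exact h1.trans (by gcongr)
  -- In dimension `d` this majorant is in `H^{2d+4}`, contained in the `H^{s+2}` needed with `s = d
  -- + 1 > d/2`.
  obtain ⟨k, hk, huk⟩ := key (Module.finrank ℝ E + 2)
  obtain ⟨f, hf, hlim, hkf⟩ := exists_contDiff_two_of_memSobolev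
    (s := Module.finrank ℝ E + 1) (by linarith [(Nat.cast_nonneg (Module.finrank ℝ E) : (0 : ℝ) ≤ _)])
    (hk.mono (by push_cast; linarith [(Nat.cast_nonneg (Module.finrank ℝ E) : (0 : ℝ) ≤ _)]))
  obtain ⟨M, hM⟩ := exists_norm_le_of_tendsto_cocompact hf.continuous hlim
  refine ⟨M, ?_⟩
  filter_upwards [huk, hkf] with x h1 h2
  exact h1.trans ((Complex.re_le_norm _).trans (h2 ▸ hM x))

end SobolevEmbedding

/-! ### Weak derivatives: product and chain rule. -/

section WeakDerivative

set_option linter.unusedSectionVars false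

open Filter Topology LineDeriv

variable {E : Type*} [NormedAddCommGroup E] [InnerProductSpace ℝ E] [FiniteDimensional ℝ E]
  [MeasurableSpace E] [BorelSpace E]

/-- `v` is the weak derivative of `u` in the direction `e`, tested against Schwartz functions. -/
def HasWeakDeriv (e : E) (u v : E → ℂ) : Prop :=
  ∀ φ : 𝓢(E, ℂ), ∫ x, (∂_{e} φ) x * u x = -∫ x, φ x * v x

theorem hasWeakDeriv_iff {e : E} {u v : E → ℂ} (hu : MemLp u 2 volume) (hv : MemLp v 2 volume) :
    HasWeakDeriv e u v ↔ ∂_{e} (hu.toLp : 𝓢'(E, ℂ)) = hv.toLp := by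
  have hint : ∀ {f : E → ℂ} (hf : MemLp f 2 volume) (φ : 𝓢(E, ℂ)),
      (hf.toLp : 𝓢'(E, ℂ)) φ = ∫ x, φ x * f x := by
    intro f hf φ
    rw [Lp.toTemperedDistribution_apply]
    refine integral_congr_ae ?_
    filter_upwards [hf.coeFn_toLp] with x hx
    rw [hx, smul_eq_mul]
  have hneg : ∀ φ : 𝓢(E, ℂ), ∫ x, (-∂_{e} φ) x * u x = -∫ x, (∂_{e} φ) x * u x := by
    intro φ
    rw [← integral_neg]
    exact integral_congr_ae (Eventually.of_forall fun x => neg_mul _ _)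
  constructor
  · intro h
    ext φ
    rw [TemperedDistribution.lineDerivOp_apply_apply, hint, hint, hneg, h φ, neg_neg]
  · intro h φ
    have := DFunLike.congr_fun h φ
    rw [TemperedDistribution.lineDerivOp_apply_apply, hint, hint, hneg] at this
    rw [← this, neg_neg]

theorem HasWeakDeriv.congr {e : E} {u v u' v' : E → ℂ} (h : HasWeakDeriv e u v)
    (hu : u =ᵐ[volume] u') (hv : v =ᵐ[volume] v') : HasWeakDeriv e u' v' := by
  intro φ
  have h1 : ∫ x, (∂_{e} φ) x * u x = ∫ x, (∂_{e} φ) x * u' x :=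
    integral_congr_ae (by filter_upwards [hu] with x hx; rw [hx])
  have h2 : ∫ x, φ x * v x = ∫ x, φ x * v' x :=
    integral_congr_ae (by filter_upwards [hv] with x hx; rw [hx])
  rw [← h1, ← h2, h φ]

theorem integrable_schwartz_mul (φ : 𝓢(E, ℂ)) {u : E → ℂ} (hu : MemLp u 2 volume) :
    Integrable fun x => φ x * u x :=
  (φ.memLp 2).integrable_mul hu

theorem HasWeakDeriv.add {e : E} {u v u' v' : E → ℂ} (h : HasWeakDeriv e u v)
    (h' : HasWeakDeriv e u' v') (hu : MemLp u 2 volume) (hv : MemLp v 2 volume)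
    (hu' : MemLp u' 2 volume) (hv' : MemLp v' 2 volume) :
    HasWeakDeriv e (fun x => u x + u' x) (fun x => v x + v' x) := by
  intro φ
  simp only [mul_add]
  rw [integral_add (integrable_schwartz_mul _ hu) (integrable_schwartz_mul _ hu'),
    integral_add (integrable_schwartz_mul _ hv) (integrable_schwartz_mul _ hv'), h φ, h' φ]
  ring

/-- An `H¹` function and its derivative in a given direction are simultaneously approximated in
`L²` by Schwartz functions. -/
theorem exists_schwartz_tendsto {e : E} {u v : Lp ℂ 2 (volume : Measure E)}
    (hu : MemSobolev 1 2 (u : 𝓢'(E, ℂ))) (huv : ∂_{e} (u : 𝓢'(E, ℂ)) = v) :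
    ∃ φ : ℕ → 𝓢(E, ℂ), Tendsto (fun n => (φ n).toLp 2 volume) atTop (𝓝 u) ∧
      Tendsto (fun n => (∂_{e} (φ n)).toLp 2 volume) atTop (𝓝 v) := by
  obtain ⟨g, hg⟩ := hu
  -- Both `u` and `v` are continuous images, under `A` and `D`, of the same `g ∈ L²`, so
  -- approximating `g` alone approximates both.
  obtain ⟨A, D, hA, hD, hA', hD'⟩ := exists_bessel_L2 (E := E) (s := -1) le_rfl e
  have hgu : besselPotential E ℂ (-1) (g : 𝓢'(E, ℂ)) = u := by
    rw [← hg, besselPotential_besselPotential_apply]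
    simp
  have hAu : A g = u := toTemperedDistribution_injective (by simp only [hA, hgu])
  have hDv : D g = v := toTemperedDistribution_injective (by simp only [hD, hgu, huv])
  have hg' : g ∈ closure (Set.range (SchwartzMap.toLpCLM ℝ ℂ 2 (volume : Measure E))) :=
    SchwartzMap.denseRange_toLpCLM (by norm_num) g
  obtain ⟨x, hx, hlim⟩ := mem_closure_iff_seq_limit.mp hg'
  choose ψ hψ using hx
  refine ⟨fun n => besselSchwartz (-1) (ψ n), ?_, ?_⟩
  · have := (A.continuous.tendsto g).comp hlim
    rw [hAu] at this
    refine this.congr fun n => ?_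
    rw [Function.comp_apply, ← hψ, ← hA']
    rfl
  · have := (D.continuous.tendsto g).comp hlim
    rw [hDv] at this
    refine this.congr fun n => ?_
    rw [Function.comp_apply, ← hψ, ← hD']
    rfl

/-- Cauchy–Schwarz bounds the integral by `‖b n‖₂ ‖G‖₂`. -/
theorem tendsto_integral_zero_of_norm_le_mul {h : ℕ → E → ℂ} {b : ℕ → E → ℝ} {G : E → ℝ}
    (hb : Tendsto (fun n => eLpNorm (b n) 2 volume) atTop (𝓝 0))
    (hbm : ∀ n, AEStronglyMeasurable (b n) volume)
    (hG : MemLp G 2 volume) (hle : ∀ n, ∀ᵐ x, ‖h n x‖ ≤ ‖b n x * G x‖) :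
    Tendsto (fun n => ∫ x, h n x) atTop (𝓝 0) := by
  rw [tendsto_zero_iff_enorm_tendsto_zero]
  have h1 : Tendsto (fun n => eLpNorm (b n) 2 volume * eLpNorm G 2 volume) atTop (𝓝 0) := by
    simpa using ENNReal.Tendsto.mul_const hb (Or.inr hG.2.ne)
  refine tendsto_of_tendsto_of_tendsto_of_le_of_le tendsto_const_nhds h1 (fun _ => zero_le) ?_
  intro n
  have h2 := eLpNorm_le_eLpNorm_mul_eLpNorm'_of_norm (p := 2) (q := 2) (r := 1) (hbm n) hG.1
    (fun a b => a * b) 1 (Eventually.of_forall fun x => by simp)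
  rw [eLpNorm_one_eq_lintegral_enorm] at h2
  calc ‖∫ x, h n x‖ₑ ≤ ∫⁻ x, ‖h n x‖ₑ := enorm_integral_le_lintegral_enorm _
    _ ≤ ∫⁻ x, ‖b n x * G x‖ₑ := by
      refine lintegral_mono_ae ?_
      filter_upwards [hle n] with x hx
      exact enorm_le_iff_norm_le.mpr hx
    _ ≤ _ := by simpa using h2

/-- Chain rule for a real-differentiable function of a complex-valued Schwartz function, after
multiplication by a test function. -/
theorem lineDeriv_smulLeft_comp {F : ℂ → ℂ} (hF : F.HasTemperateGrowth) (ψ φ : 𝓢(E, ℂ)) (e x : E) :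
    (∂_{e} (SchwartzMap.smulLeftCLM ℂ (F ∘ ψ) φ)) x
      = F (ψ x) * (∂_{e} φ) x + (fderiv ℝ F (ψ x) 1 * (((∂_{e} ψ) x).re : ℂ)
        + fderiv ℝ F (ψ x) Complex.I * (((∂_{e} ψ) x).im : ℂ)) * φ x := by
  have hFψ : (F ∘ ψ).HasTemperateGrowth := hF.comp ψ.hasTemperateGrowth
  have hd : HasFDerivAt F (fderiv ℝ F (ψ x)) (ψ x) :=
    (hF.1.differentiable (by simp) _).hasFDerivAt
  have h1 := (hd.comp x (ψ.hasFDerivAt x)).mul (φ.hasFDerivAt x)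
  have h2 := h1.fderiv
  rw [show (F ∘ ψ * φ : E → ℂ) = SchwartzMap.smulLeftCLM ℂ (F ∘ ψ) φ from
    (SchwartzMap.smulLeftCLM_apply hFψ φ).symm] at h2
  rw [SchwartzMap.lineDerivOp_apply_eq_fderiv, h2, SchwartzMap.lineDerivOp_apply_eq_fderiv,
    SchwartzMap.lineDerivOp_apply_eq_fderiv]
  set z := fderiv ℝ ψ x e with hz
  have h3 : fderiv ℝ F (ψ x) z = fderiv ℝ F (ψ x) 1 * (z.re : ℂ)
      + fderiv ℝ F (ψ x) Complex.I * (z.im : ℂ) := by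
    have h4 : z = z.re • (1 : ℂ) + z.im • Complex.I := by
      simp [Complex.re_add_im]
    conv_lhs => rw [h4, map_add, map_smul, map_smul]
    simp only [Complex.real_smul]
    ring
  rw [← h3]
  simp [hz, mul_comm]

theorem exists_bound_lipschitz_of_hasCompactSupport {F : ℂ → ℂ} (hF : ContDiff ℝ 1 F)
    (hFc : HasCompactSupport F) :
    ∃ K : ℝ, 0 ≤ K ∧ (∀ z, ‖F z‖ ≤ K) ∧ ∀ z w, ‖F z - F w‖ ≤ K * ‖z - w‖ := by
  obtain ⟨L, hL⟩ := hF.lipschitzWith_of_hasCompactSupport hFc one_ne_zero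
  obtain ⟨B, hB⟩ := hFc.exists_bound_of_continuous hF.continuous
  refine ⟨max B L, le_max_of_le_right L.2, fun z => (hB z).trans (le_max_left _ _), fun z w => ?_⟩
  refine (hL.norm_sub_le z w).trans ?_
  gcongr
  exact le_max_right _ _

theorem norm_mul_sub_mul_le {K a b c : ℝ} {f g p q : ℂ} (hK : 0 ≤ K) (hf : ‖f‖ ≤ K)
    (hfg : ‖f - g‖ ≤ K * a) (hpq : ‖p - q‖ ≤ b) (hq : ‖q‖ ≤ c) :
    ‖f * p - g * q‖ ≤ K * b + K * a * c := by
  rw [show f * p - g * q = f * (p - q) + (f - g) * q by ring]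
  refine (norm_add_le _ _).trans ?_
  rw [norm_mul, norm_mul]
  gcongr
  exact (norm_nonneg _).trans hfg

theorem Lp.tendsto_eLpNorm_schwartz_sub {φ : ℕ → 𝓢(E, ℂ)} {u : E → ℂ} (hu : MemLp u 2 volume)
    (h : Tendsto (fun n => (φ n).toLp 2 volume) atTop (𝓝 hu.toLp)) :
    Tendsto (fun n => eLpNorm (fun x => φ n x - u x) 2 volume) atTop (𝓝 0) := by
  rw [Lp.tendsto_Lp_iff_tendsto_eLpNorm'] at h
  refine h.congr fun n => eLpNorm_congr_ae ?_
  filter_upwards [(φ n).coeFn_toLp 2 volume, hu.coeFn_toLp] with x h1 h2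
  rw [Pi.sub_apply, h1, h2]

/-- Only `u` is approximated, by Schwartz `ψ n`. Then `F(ψ n) φ` is an admissible test function for
the weak derivative of `w`, and the limit is taken using that `F` and its first partial derivatives
are bounded and Lipschitz. The error contains `|ψ n - u| |u'| |w|`; boundedness of `w` reduces it to
a product of two `L²` functions. -/
theorem HasWeakDeriv.comp_mul_of_hasCompactSupport {e : E} {F : ℂ → ℂ}
    (hF : ContDiff ℝ (⊤ : ℕ∞) F) (hFc : HasCompactSupport F) {u u' w w' : E → ℂ}
    (hu : MemLp u 2 volume) (hu' : MemLp u' 2 volume) (hw : MemLp w 2 volume)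
    (hw' : MemLp w' 2 volume) (hwb : ∃ M, ∀ᵐ x, ‖w x‖ ≤ M)
    (hu1 : MemSobolev 1 2 (hu.toLp : 𝓢'(E, ℂ)))
    (huu' : HasWeakDeriv e u u') (hww' : HasWeakDeriv e w w') :
    HasWeakDeriv e (fun x => F (u x) * w x)
      (fun x => F (u x) * w' x + (fderiv ℝ F (u x) 1 * ((u' x).re : ℂ)
        + fderiv ℝ F (u x) Complex.I * ((u' x).im : ℂ)) * w x) := by
  intro φ
  obtain ⟨ψ, hψ, hψ'⟩ := exists_schwartz_tendsto hu1 ((hasWeakDeriv_iff hu hu').mp huu')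
  obtain ⟨M, hM⟩ := hwb
  have hfd : ∀ z : ℂ, ContDiff ℝ 1 fun y => fderiv ℝ F y z := fun z =>
    (hF.fderiv_right (m := 1) (by norm_cast)).clm_apply contDiff_const
  have hfdc : ∀ z : ℂ, HasCompactSupport fun y => fderiv ℝ F y z := fun z =>
    (hFc.fderiv (𝕜 := ℝ)).comp_left (g := fun L : ℂ →L[ℝ] ℂ => L z) rfl
  set F₁ : ℂ → ℂ := fun y => fderiv ℝ F y 1 with hF₁
  set F₂ : ℂ → ℂ := fun y => fderiv ℝ F y Complex.I with hF₂
  obtain ⟨K₀, hK₀, hb₀, hl₀⟩ := exists_bound_lipschitz_of_hasCompactSupport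
    (hF.of_le (by norm_cast)) hFc
  obtain ⟨K₁, hK₁, hb₁, hl₁⟩ := exists_bound_lipschitz_of_hasCompactSupport (hfd 1) (hfdc 1)
  obtain ⟨K₂, hK₂, hb₂, hl₂⟩ := exists_bound_lipschitz_of_hasCompactSupport (hfd Complex.I)
    (hfdc Complex.I)
  obtain ⟨C, hC⟩ : ∃ C : ℝ, ∀ x, ‖φ x‖ ≤ C ∧ ‖(∂_{e} φ) x‖ ≤ C :=
    ⟨max (SchwartzMap.seminorm ℝ 0 0 φ) (SchwartzMap.seminorm ℝ 0 0 (∂_{e} φ)), fun x =>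
      ⟨(φ.norm_le_seminorm ℝ x).trans (le_max_left _ _),
        ((∂_{e} φ).norm_le_seminorm ℝ x).trans (le_max_right _ _)⟩⟩
  have hC0 : 0 ≤ C := (norm_nonneg _).trans (hC 0).1
  have hre : ∀ z : ℂ, ‖(z.re : ℂ)‖ ≤ ‖z‖ := fun z => by
    rw [Complex.norm_real]; exact Complex.abs_re_le_norm z
  have him : ∀ z : ℂ, ‖(z.im : ℂ)‖ ≤ ‖z‖ := fun z => by
    rw [Complex.norm_real]; exact Complex.abs_im_le_norm z
  have hFtg : F.HasTemperateGrowth := hFc.hasTemperateGrowth hF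
  set θ : ℕ → 𝓢(E, ℂ) := fun n => SchwartzMap.smulLeftCLM ℂ (F ∘ ψ n) φ with hθ
  have hθx : ∀ n x, θ n x = F (ψ n x) * φ x := fun n x => by
    rw [hθ, SchwartzMap.smulLeftCLM_apply_apply (hFtg.comp (ψ n).hasTemperateGrowth)]
    rfl
  have hθd : ∀ n x, (∂_{e} (θ n)) x = _ := fun n x => lineDeriv_smulLeft_comp hFtg (ψ n) φ e x
  set V : E → ℂ := fun x => F (u x) * w' x + (F₁ (u x) * ((u' x).re : ℂ)
        + F₂ (u x) * ((u' x).im : ℂ)) * w x with hV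
  have hcomp : ∀ {G : ℂ → ℂ}, Continuous G → AEStronglyMeasurable (fun x => G (u x)) volume :=
    fun hG => hG.comp_aestronglyMeasurable hu.1
  have hVm : MemLp V 2 volume := by
    have hg : MemLp (fun x => K₀ * ‖w' x‖ + (K₁ + K₂) * M * ‖u' x‖) 2 volume :=
      (hw'.norm.const_mul _).add (hu'.norm.const_mul _)
    refine hg.mono' ?_ ?_
    · exact ((hcomp hF.continuous).mul hw'.1).add ((((hcomp (hfd 1).continuous).mul
        (Complex.continuous_ofReal.comp_aestronglyMeasurable
          (Complex.continuous_re.comp_aestronglyMeasurable hu'.1))).add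
        ((hcomp (hfd Complex.I).continuous).mul
        (Complex.continuous_ofReal.comp_aestronglyMeasurable
          (Complex.continuous_im.comp_aestronglyMeasurable hu'.1)))).mul hw.1)
    · filter_upwards [hM] with x hx
      have h1 : ‖F₁ (u x) * ((u' x).re : ℂ) + F₂ (u x) * ((u' x).im : ℂ)‖
          ≤ K₁ * ‖u' x‖ + K₂ * ‖u' x‖ := by
        refine (norm_add_le _ _).trans ?_
        rw [norm_mul, norm_mul]
        gcongr
        exacts [hb₁ _, hre _, hb₂ _, him _]
      calc ‖V x‖ ≤ K₀ * ‖w' x‖ + (K₁ * ‖u' x‖ + K₂ * ‖u' x‖) * M := by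
            refine (norm_add_le _ _).trans ?_
            rw [norm_mul, norm_mul]
            gcongr
            exact hb₀ _
        _ = _ := by ring
  have hFw : MemLp (fun x => F (u x) * w x) 2 volume := by
    refine (hw.norm.const_mul K₀).mono' ((hcomp hF.continuous).mul hw.1)
      (Eventually.of_forall fun x => ?_)
    rw [norm_mul]
    gcongr
    exact hb₀ _
  set H : E → ℂ := fun x => (∂_{e} φ) x * (F (u x) * w x) + φ x * V x with hH
  set h : ℕ → E → ℂ := fun n x => (∂_{e} (θ n)) x * w x + θ n x * w' x with hh
  have hHi : Integrable H := (integrable_schwartz_mul _ hFw).add (integrable_schwartz_mul _ hVm)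
  have hhi : ∀ n, Integrable (h n) := fun n =>
    (integrable_schwartz_mul _ hw).add (integrable_schwartz_mul _ hw')
  have hh0 : ∀ n, ∫ x, h n x = 0 := fun n => by
    rw [integral_add (integrable_schwartz_mul _ hw) (integrable_schwartz_mul _ hw'), hww' (θ n)]
    ring
  set b : ℕ → E → ℝ := fun n x => ‖ψ n x - u x‖ + ‖(∂_{e} (ψ n)) x - u' x‖ with hb
  have hm1 : ∀ n, AEStronglyMeasurable (fun x => ψ n x - u x) volume := fun n =>
    (ψ n).continuous.aestronglyMeasurable.sub hu.1
  have hm2 : ∀ n, AEStronglyMeasurable (fun x => (∂_{e} (ψ n)) x - u' x) volume := fun n =>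
    (∂_{e} (ψ n)).continuous.aestronglyMeasurable.sub hu'.1
  have hblim : Tendsto (fun n => eLpNorm (b n) 2 volume) atTop (𝓝 0) := by
    have h3 := (Lp.tendsto_eLpNorm_schwartz_sub hu hψ).add
      (Lp.tendsto_eLpNorm_schwartz_sub hu' hψ')
    rw [add_zero] at h3
    refine tendsto_of_tendsto_of_tendsto_of_le_of_le tendsto_const_nhds h3 (fun _ => zero_le)
      fun n => ?_
    refine (eLpNorm_add_le (hm1 n).norm (hm2 n).norm (by norm_num)).trans ?_
    rw [eLpNorm_norm, eLpNorm_norm]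
  set G : E → ℝ := fun x => K₀ * C * (‖w x‖ + ‖w' x‖) + (K₁ + K₂) * C * ‖w x‖
    + (K₁ + K₂) * C * M * ‖u' x‖ with hG
  have hGm : MemLp G 2 volume :=
    (((hw.norm.add hw'.norm).const_mul _).add (hw.norm.const_mul _)).add (hu'.norm.const_mul _)
  have hdiff : Tendsto (fun n => ∫ x, (h n x - H x)) atTop (𝓝 0) := by
    refine tendsto_integral_zero_of_norm_le_mul hblim (fun n => (hm1 n).norm.add (hm2 n).norm) hGm
      fun n => ?_
    filter_upwards [hM] with x hx
    have hM0 : 0 ≤ M := (norm_nonneg _).trans hx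
    set α := ‖ψ n x - u x‖ with hα
    set β := ‖(∂_{e} (ψ n)) x - u' x‖ with hβ
    have hα0 : 0 ≤ α := norm_nonneg _
    have hβ0 : 0 ≤ β := norm_nonneg _
    have e1 : ‖F₁ (ψ n x) * (((∂_{e} (ψ n)) x).re : ℂ) - F₁ (u x) * ((u' x).re : ℂ)‖
        ≤ K₁ * β + K₁ * α * ‖u' x‖ :=
      norm_mul_sub_mul_le hK₁ (hb₁ _) (hl₁ _ _) (by
        rw [← Complex.ofReal_sub, ← Complex.sub_re]; exact hre _) (hre _)
    have e2 : ‖F₂ (ψ n x) * (((∂_{e} (ψ n)) x).im : ℂ) - F₂ (u x) * ((u' x).im : ℂ)‖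
        ≤ K₂ * β + K₂ * α * ‖u' x‖ :=
      norm_mul_sub_mul_le hK₂ (hb₂ _) (hl₂ _ _) (by
        rw [← Complex.ofReal_sub, ← Complex.sub_im]; exact him _) (him _)
    have e3 : h n x - H x = (F (ψ n x) - F (u x)) * ((∂_{e} φ) x * w x + φ x * w' x)
        + ((F₁ (ψ n x) * (((∂_{e} (ψ n)) x).re : ℂ) - F₁ (u x) * ((u' x).re : ℂ))
          + (F₂ (ψ n x) * (((∂_{e} (ψ n)) x).im : ℂ) - F₂ (u x) * ((u' x).im : ℂ)))
          * (φ x * w x) := by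
      simp only [hh, hH, hV, hθd, hθx, hF₁, hF₂]
      ring
    have hG0 : 0 ≤ G x := by positivity
    rw [e3, Real.norm_of_nonneg (by positivity)]
    calc _ ≤ (K₀ * α) * (C * ‖w x‖ + C * ‖w' x‖)
          + ((K₁ * β + K₁ * α * ‖u' x‖) + (K₂ * β + K₂ * α * ‖u' x‖)) * (C * ‖w x‖) := by
          refine (norm_add_le _ _).trans ?_
          rw [norm_mul, norm_mul]
          gcongr
          · exact hl₀ _ _
          · refine (norm_add_le _ _).trans ?_
            rw [norm_mul, norm_mul]
            gcongr
            exacts [(hC x).2, (hC x).1]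
          · exact (norm_add_le _ _).trans (add_le_add e1 e2)
          · rw [norm_mul]
            gcongr
            exact (hC x).1
      _ = α * (K₀ * C * (‖w x‖ + ‖w' x‖)) + β * ((K₁ + K₂) * C * ‖w x‖)
          + α * ((K₁ + K₂) * C * ‖w x‖ * ‖u' x‖) := by ring
      _ ≤ α * (K₀ * C * (‖w x‖ + ‖w' x‖)) + β * ((K₁ + K₂) * C * ‖w x‖)
          + α * ((K₁ + K₂) * C * M * ‖u' x‖) := by gcongr
      _ ≤ (α + β) * (K₀ * C * (‖w x‖ + ‖w' x‖)) + (α + β) * ((K₁ + K₂) * C * ‖w x‖)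
          + (α + β) * ((K₁ + K₂) * C * M * ‖u' x‖) := by
          gcongr <;> linarith
      _ = b n x * G x := by simp only [hb, hG]; ring
  have hlim : Tendsto (fun _ : ℕ => -∫ x, H x) atTop (𝓝 0) := by
    refine hdiff.congr fun n => ?_
    rw [integral_sub (hhi n) hHi, hh0, zero_sub]
  have hH0 : ∫ x, H x = 0 := by
    have := tendsto_nhds_unique tendsto_const_nhds hlim
    exact neg_eq_zero.mp this
  rw [integral_add (integrable_schwartz_mul _ hFw) (integrable_schwartz_mul _ hVm)] at hH0
  exact eq_neg_of_add_eq_zero_left hH0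

/-- Product and chain rule: the weak derivative of `F(u) w` for bounded `u`, `w` and smooth `F`. -/
theorem HasWeakDeriv.comp_mul {e : E} {F : ℂ → ℂ}
    (hF : ContDiff ℝ (⊤ : ℕ∞) F) {u u' w w' : E → ℂ}
    (hu : MemLp u 2 volume) (hu' : MemLp u' 2 volume) (hw : MemLp w 2 volume)
    (hw' : MemLp w' 2 volume) (hub : ∃ M, ∀ᵐ x, ‖u x‖ ≤ M) (hwb : ∃ M, ∀ᵐ x, ‖w x‖ ≤ M)
    (hu1 : MemSobolev 1 2 (hu.toLp : 𝓢'(E, ℂ)))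
    (huu' : HasWeakDeriv e u u') (hww' : HasWeakDeriv e w w') :
    HasWeakDeriv e (fun x => F (u x) * w x)
      (fun x => F (u x) * w' x + (fderiv ℝ F (u x) 1 * ((u' x).re : ℂ)
        + fderiv ℝ F (u x) Complex.I * ((u' x).im : ℂ)) * w x) := by
  obtain ⟨M, hM⟩ := hub
  -- The inner radius strictly exceeds the bound on `u`, so the cut-off function agrees with `F` in
  -- a neighbourhood of each value of `u`, and so do their derivatives.
  let b : ContDiffBump (0 : ℂ) := ⟨|M| + 1, |M| + 2, by positivity, by linarith⟩
  set N : ℂ → ℂ := fun z => b z • F z with hN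
  have hNs : ContDiff ℝ (⊤ : ℕ∞) N := b.contDiff.smul hF
  have hNc : HasCompactSupport N := b.hasCompactSupport.smul_right
  have heq : ∀ z : ℂ, ‖z‖ ≤ M → N =ᶠ[𝓝 z] F := by
    intro z hz
    have hz' : z ∈ Metric.ball (0 : ℂ) (|M| + 1) := by
      rw [mem_ball_zero_iff]
      linarith [le_abs_self M]
    filter_upwards [Metric.isOpen_ball.mem_nhds hz'] with y hy
    rw [hN]
    simp only
    rw [b.one_of_mem_closedBall (Metric.ball_subset_closedBall hy), one_smul]
  refine (HasWeakDeriv.comp_mul_of_hasCompactSupport hNs hNc hu hu' hw hw' hwb hu1 huu' hww').congr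
    ?_ ?_
  · filter_upwards [hM] with x hx
    rw [(heq _ hx).eq_of_nhds]
  · filter_upwards [hM] with x hx
    rw [(heq _ hx).eq_of_nhds, (heq _ hx).fderiv_eq]

end WeakDerivative

/-! ### The scale `W^{k,2} ∩ W^{k,∞}`: composition and elliptic regularity. -/

section BoundedSobolev

set_option linter.unusedSectionVars false

open Filter Topology LineDeriv

variable {E : Type*} [NormedAddCommGroup E] [InnerProductSpace ℝ E] [FiniteDimensional ℝ E]
  [MeasurableSpace E] [BorelSpace E]

/-- `W^{k,2} ∩ W^{k,∞}`: functions all of whose weak derivatives of order at most `k` are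
in `L² ∩ L^∞`. -/
def BddSobolev : ℕ → (E → ℂ) → Prop
  | 0, u => MemLp u 2 volume ∧ ∃ M, ∀ᵐ x, ‖u x‖ ≤ M
  | k + 1, u => (MemLp u 2 volume ∧ ∃ M, ∀ᵐ x, ‖u x‖ ≤ M) ∧
      ∀ e : E, ‖e‖ = 1 → ∃ v, BddSobolev k v ∧ HasWeakDeriv e u v

namespace BddSobolev

theorem base {k : ℕ} {u : E → ℂ} (h : BddSobolev k u) :
    MemLp u 2 volume ∧ ∃ M, ∀ᵐ x, ‖u x‖ ≤ M := by
  cases k with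
  | zero => exact h
  | succ k => exact h.1

theorem of_succ {k : ℕ} : ∀ {u : E → ℂ}, BddSobolev (k + 1) u → BddSobolev k u := by
  induction k with
  | zero => exact fun h => h.1
  | succ k ih =>
    intro u h
    refine ⟨h.1, fun e he => ?_⟩
    obtain ⟨v, hv, huv⟩ := h.2 e he
    exact ⟨v, ih hv, huv⟩

theorem mono {k l : ℕ} (hkl : k ≤ l) {u : E → ℂ} (h : BddSobolev l u) : BddSobolev k u := by
  induction hkl with
  | refl => exact h
  | step _ ih => exact ih h.of_succ

theorem congr {k : ℕ} {u v : E → ℂ} (h : BddSobolev k u) (huv : u =ᵐ[volume] v) :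
    BddSobolev k v := by
  have hb : MemLp v 2 volume ∧ ∃ M, ∀ᵐ x, ‖v x‖ ≤ M := by
    obtain ⟨h1, M, hM⟩ := h.base
    refine ⟨h1.ae_eq huv, M, ?_⟩
    filter_upwards [hM, huv] with x hx hx'
    rwa [← hx']
  cases k with
  | zero => exact hb
  | succ k =>
    refine ⟨hb, fun e he => ?_⟩
    obtain ⟨w, hw, huw⟩ := h.2 e he
    exact ⟨w, hw, huw.congr huv (ae_eq_refl _)⟩

theorem add {k : ℕ} : ∀ {u v : E → ℂ}, BddSobolev k u → BddSobolev k v →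
    BddSobolev k fun x => u x + v x := by
  have hb : ∀ {u v : E → ℂ}, BddSobolev 0 u → BddSobolev 0 v →
      BddSobolev 0 fun x => u x + v x := by
    rintro u v ⟨hu, M, hM⟩ ⟨hv, N, hN⟩
    refine ⟨hu.add hv, M + N, ?_⟩
    filter_upwards [hM, hN] with x h1 h2
    exact (norm_add_le _ _).trans (add_le_add h1 h2)
  induction k with
  | zero => exact hb
  | succ k ih =>
    intro u v hu hv
    refine ⟨hb hu.base hv.base, fun e he => ?_⟩
    obtain ⟨u', hu', huu'⟩ := hu.2 e he
    obtain ⟨v', hv', hvv'⟩ := hv.2 e he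
    exact ⟨_, ih hu' hv', huu'.add hvv' hu.base.1 hu'.base.1 hv.base.1 hv'.base.1⟩

/-- In the inductive step first derivatives are in `H^k`, so `Δu` and hence `u - (2π)⁻² Δu` are in
`H^{k-1}`; inverting gains two orders. -/
theorem memSobolev {k : ℕ} : ∀ {u : E → ℂ}, BddSobolev k u → ∀ hu : MemLp u 2 volume,
    MemSobolev k 2 (hu.toLp : 𝓢'(E, ℂ)) := by
  induction k with
  | zero =>
    intro u _ hu
    rw [Nat.cast_zero, memSobolev_zero_iff]
    exact ⟨_, rfl⟩
  | succ k ih =>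
    intro u h hu
    have h1 := ih h.of_succ hu
    have h2 : ∀ i, MemSobolev ((k : ℝ) - 1) 2 (∂_{stdOrthonormalBasis ℝ E i}
        (∂_{stdOrthonormalBasis ℝ E i} (hu.toLp : 𝓢'(E, ℂ)))) := by
      intro i
      obtain ⟨v, hv, huv⟩ := h.2 (stdOrthonormalBasis ℝ E i)
        ((stdOrthonormalBasis ℝ E).orthonormal.norm_eq_one i)
      rw [(hasWeakDeriv_iff hu hv.base.1).mp huv]
      exact (ih hv hv.base.1).lineDerivOp
    have h3 : MemSobolev ((k : ℝ) - 1) 2 (Δ (hu.toLp : 𝓢'(E, ℂ))) := by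
      rw [TemperedDistribution.laplacian_eq_sum (stdOrthonormalBasis ℝ E)]
      exact Finset.sum_induction _ (MemSobolev ((k : ℝ) - 1) 2) (fun _ _ ha hb => ha.add hb)
        (memSobolev_fun_zero E ℂ _ _) fun i _ => h2 i
    have h4 : MemSobolev ((k : ℝ) - 1) 2 (besselPotential E ℂ 2 (hu.toLp : 𝓢'(E, ℂ))) := by
      have h5 := (h1.mono (by linarith)).sub (h3.smul (((2 * Real.pi) ^ 2)⁻¹ : ℝ))
      rwa [besselPotential_two_eq]
    rw [memSobolev_besselPotential_iff] at h4
    convert! h4 using 1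
    push_cast
    ring

theorem comp_mul_zero {F : ℂ → ℂ} (hF : Continuous F) {u w : E → ℂ}
    (hu : BddSobolev 0 u) (hw : BddSobolev 0 w) : BddSobolev 0 fun x => F (u x) * w x := by
  obtain ⟨hu, M, hM⟩ := hu
  obtain ⟨hw, N, hN⟩ := hw
  obtain ⟨K, hK⟩ := (isCompact_closedBall (0 : ℂ) M).exists_bound_of_continuousOn hF.continuousOn
  have hle : ∀ᵐ x, ‖F (u x) * w x‖ ≤ K * ‖w x‖ := by
    filter_upwards [hM] with x hx
    rw [norm_mul]
    gcongr
    exact hK _ (by simpa using hx)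
  refine ⟨(hw.norm.const_mul K).mono' ((hF.comp_aestronglyMeasurable hu.1).mul hw.1) hle,
    |K| * N, ?_⟩
  filter_upwards [hle, hN] with x h1 h2
  calc _ ≤ K * ‖w x‖ := h1
    _ ≤ |K| * ‖w x‖ := by gcongr; exact le_abs_self K
    _ ≤ |K| * N := by gcongr

/-- `W^{k,2} ∩ W^{k,∞}` is stable under `(u, w) ↦ F(u) w` for smooth `F`. -/
theorem comp_mul {k : ℕ} : ∀ {F : ℂ → ℂ}, ContDiff ℝ (⊤ : ℕ∞) F → ∀ {u w : E → ℂ},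
    BddSobolev k u → BddSobolev k w → BddSobolev k fun x => F (u x) * w x := by
  induction k with
  | zero => exact fun hF _ _ hu hw => comp_mul_zero hF.continuous hu hw
  | succ k ih =>
    intro F hF u w hu hw
    refine ⟨comp_mul_zero hF.continuous hu.base hw.base, fun e he => ?_⟩
    obtain ⟨u', hu', huu'⟩ := hu.2 e he
    obtain ⟨w', hw', hww'⟩ := hw.2 e he
    have hH1 : MemSobolev 1 2 (hu.base.1.toLp : 𝓢'(E, ℂ)) := by
      simpa using (hu.mono (Nat.le_add_left 1 k)).memSobolev hu.base.1
    have hfd : ∀ z : ℂ, ContDiff ℝ (⊤ : ℕ∞) fun y => fderiv ℝ F y z := fun z =>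
      (hF.fderiv_right (m := (⊤ : ℕ∞)) (by norm_cast)).clm_apply contDiff_const
    have hre : ContDiff ℝ (⊤ : ℕ∞) fun z : ℂ => (z.re : ℂ) :=
      (Complex.ofRealCLM ∘L Complex.reCLM).contDiff
    have him : ContDiff ℝ (⊤ : ℕ∞) fun z : ℂ => (z.im : ℂ) :=
      (Complex.ofRealCLM ∘L Complex.imCLM).contDiff
    -- Every term of the derivative is again a smooth function of one factor times another, at order
    -- `k`: the induction ranges over all `F`, so it covers the partial derivatives of `F` and also
    -- `re` and `im` applied to `u'`.
    have h1 := ih hF hu.of_succ hw'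
    have h2 := ih (hfd 1) hu.of_succ (ih hre hu' hw.of_succ)
    have h3 := ih (hfd Complex.I) hu.of_succ (ih him hu' hw.of_succ)
    refine ⟨_, (h1.add (h2.add h3)).congr (Eventually.of_forall fun x => ?_),
      HasWeakDeriv.comp_mul hF hu.base.1 hu'.base.1 hw.base.1 hw'.base.1 hu.base.2 hw.base.2 hH1
        huu' hww'⟩
    simp only
    ring

theorem _root_.besselPotential_lineDeriv (s : ℝ) (e : E) (f : 𝓢'(E, ℂ)) :
    besselPotential E ℂ s (∂_{e} f) = ∂_{e} (besselPotential E ℂ s f) := by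
  rw [TemperedDistribution.lineDeriv_eq_fourierMultiplierCLM,
    TemperedDistribution.lineDeriv_eq_fourierMultiplierCLM, map_smul, besselPotential,
    fourierMultiplierCLM_fourierMultiplierCLM_apply (by fun_prop) (by fun_prop),
    fourierMultiplierCLM_fourierMultiplierCLM_apply (by fun_prop) (by fun_prop)]
  congr 3
  exact mul_comm _ _

/-- Elliptic regularity for `1 - (2π)⁻² Δ` in `W^{k,2} ∩ W^{k,∞}`. -/
theorem of_eq_besselPotential {k : ℕ} : ∀ {u g : Lp ℂ 2 (volume : Measure E)},
    (u : 𝓢'(E, ℂ)) = besselPotential E ℂ (-2) (g : 𝓢'(E, ℂ)) → BddSobolev k g →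
    BddSobolev (k + 1) u := by
  induction k with
  | zero =>
    intro u g hug hg
    refine ⟨⟨Lp.memLp u, ae_bound_of_eq_besselPotential hug hg.2⟩, fun e he => ?_⟩
    obtain ⟨v, huv, hv⟩ := exists_lineDeriv_ae_bound_of_eq_besselPotential hug hg.2 he
    refine ⟨v, ⟨Lp.memLp v, hv⟩, (hasWeakDeriv_iff (Lp.memLp u) (Lp.memLp v)).mpr ?_⟩
    rwa [Lp.toLp_coeFn, Lp.toLp_coeFn]
  | succ k ih =>
    intro u g hug hg
    refine ⟨⟨Lp.memLp u, ae_bound_of_eq_besselPotential hug hg.base.2⟩, fun e he => ?_⟩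
    obtain ⟨v, huv, -⟩ := exists_lineDeriv_ae_bound_of_eq_besselPotential hug hg.base.2 he
    obtain ⟨g', hg', hgg'⟩ := hg.2 e he
    have h1 := (hasWeakDeriv_iff (Lp.memLp g) hg'.base.1).mp hgg'
    rw [Lp.toLp_coeFn] at h1
    -- The differentiated equation has the same form, because Fourier multipliers commute.
    have h2 : (v : 𝓢'(E, ℂ)) = besselPotential E ℂ (-2) (hg'.base.1.toLp : 𝓢'(E, ℂ)) := by
      rw [← huv, hug, ← h1, besselPotential_lineDeriv]
    refine ⟨v, ih h2 (hg'.congr hg'.base.1.coeFn_toLp.symm),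
      (hasWeakDeriv_iff (Lp.memLp u) (Lp.memLp v)).mpr ?_⟩
    rwa [Lp.toLp_coeFn, Lp.toLp_coeFn]

end BddSobolev

end BoundedSobolev

/-! ### From the distributional to the classical Laplacian. -/

section ClassicalEquation

open Filter Topology

variable {E : Type*} [NormedAddCommGroup E] [InnerProductSpace ℝ E]

theorem ContDiff.iteratedFDeriv_two_eq_fderiv_fderiv {f : E → ℂ} (hf : ContDiff ℝ 2 f) (x v : E) :
    iteratedFDeriv ℝ 2 f x ![v, v] = fderiv ℝ (fun y => fderiv ℝ f y v) x v := by
  have h : ContDiff ℝ 1 (fderiv ℝ f) := hf.fderiv_right (by norm_num)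
  rw [iteratedFDeriv_two_apply,
    fderiv_clm_apply (h.differentiable one_ne_zero x) (differentiableAt_const v)]
  simp

theorem ContDiff.continuous_laplacian [FiniteDimensional ℝ E] {f : E → ℂ} (hf : ContDiff ℝ 2 f) :
    Continuous (Δ f) := by
  rw [InnerProductSpace.laplacian_eq_iteratedFDeriv_stdOrthonormalBasis]
  refine continuous_finsetSum _ fun i _ => ?_
  have h := hf.continuous_iteratedFDeriv (m := 2) le_rfl
  fun_prop

variable [FiniteDimensional ℝ E] [MeasurableSpace E] [BorelSpace E]

theorem integral_mul_fderiv_fderiv {φ f : E → ℂ} (hφ : ContDiff ℝ 2 φ) (hc : HasCompactSupport φ)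
    (hf : ContDiff ℝ 2 f) (v : E) :
    ∫ x, φ x * iteratedFDeriv ℝ 2 f x ![v, v] = ∫ x, iteratedFDeriv ℝ 2 φ x ![v, v] * f x := by
  simp_rw [hφ.iteratedFDeriv_two_eq_fderiv_fderiv, hf.iteratedFDeriv_two_eq_fderiv_fderiv]
  have h1 : ∀ {g : E → ℂ}, ContDiff ℝ 2 g → ContDiff ℝ 1 fun y => fderiv ℝ g y v := fun hg =>
    (hg.fderiv_right (m := 1) (by norm_num)).clm_apply contDiff_const
  have h2 : ∀ {g : E → ℂ}, ContDiff ℝ 1 g → Continuous fun y => fderiv ℝ g y v := fun hg =>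
    (hg.continuous_fderiv one_ne_zero).clm_apply continuous_const
  have hc1 := hc.fderiv_apply (𝕜 := ℝ) v
  have hc2 := hc1.fderiv_apply (𝕜 := ℝ) v
  have hint : ∀ {a b : E → ℂ}, HasCompactSupport a → Continuous a → Continuous b →
      Integrable fun x => a x * b x := fun ha hac hb =>
    (hac.mul hb).integrable_of_hasCompactSupport ha.mul_right
  have hφ1 := h1 hφ
  have hf1 := h1 hf
  rw [integral_mul_fderiv_eq_neg_fderiv_mul_of_integrable
      (hint hc1 hφ1.continuous hf1.continuous) (hint hc hφ.continuous (h2 hf1))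
      (hint hc hφ.continuous hf1.continuous) (fun x _ => hφ.differentiable two_ne_zero x)
      (fun x _ => hf1.differentiable one_ne_zero x),
    integral_mul_fderiv_eq_neg_fderiv_mul_of_integrable
      (hint hc2 (h2 hφ1) hf.continuous) (hint hc1 hφ1.continuous hf1.continuous)
      (hint hc1 hφ1.continuous hf.continuous) (fun x _ => hφ1.differentiable one_ne_zero x)
      (fun x _ => hf.differentiable two_ne_zero x), neg_neg]

theorem integral_mul_laplacian {φ f : E → ℂ} (hφ : ContDiff ℝ 2 φ) (hc : HasCompactSupport φ)
    (hf : ContDiff ℝ 2 f) : ∫ x, φ x * Δ f x = ∫ x, Δ φ x * f x := by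
  have hd : ∀ {g : E → ℂ} (v : E), ContDiff ℝ 2 g →
      Continuous fun x => iteratedFDeriv ℝ 2 g x ![v, v] := fun v hg => by
    have := hg.continuous_iteratedFDeriv (m := 2) le_rfl
    fun_prop
  have hcs : ∀ v, HasCompactSupport fun x => iteratedFDeriv ℝ 2 φ x ![v, v] := fun v => by
    simp_rw [hφ.iteratedFDeriv_two_eq_fderiv_fderiv]
    exact (hc.fderiv_apply (𝕜 := ℝ) v).fderiv_apply (𝕜 := ℝ) v
  simp_rw [InnerProductSpace.laplacian_eq_iteratedFDeriv_stdOrthonormalBasis, Finset.mul_sum,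
    Finset.sum_mul]
  rw [integral_finsetSum, integral_finsetSum]
  · exact Finset.sum_congr rfl fun i _ => integral_mul_fderiv_fderiv hφ hc hf _
  · exact fun i _ => ((hd _ hφ).mul hf.continuous).integrable_of_hasCompactSupport (hcs _).mul_right
  · exact fun i _ => (hφ.continuous.mul (hd _ hf)).integrable_of_hasCompactSupport hc.mul_right

/-- If the distributional Laplacian of a `C²` function is an `L²` function, it is the classical
Laplacian. -/
theorem laplacian_ae_eq_of_toTemperedDistribution {u g : Lp ℂ 2 (volume : Measure E)}
    (h : Δ (u : 𝓢'(E, ℂ)) = (g : 𝓢'(E, ℂ))) {f : E → ℂ} (hf : ContDiff ℝ 2 f)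
    (hu : u =ᵐ[volume] f) : g =ᵐ[volume] Δ f := by
  refine ae_eq_of_integral_contDiff_smul_eq
    ((Lp.memLp g).locallyIntegrable (by norm_num)) hf.continuous_laplacian.locallyIntegrable
    fun φ hφ hφc => ?_
  have hc : HasCompactSupport (Complex.ofRealCLM ∘ φ) := hφc.comp_left rfl
  have hs : ContDiff ℝ (⊤ : ℕ∞) (Complex.ofRealCLM ∘ φ) := by fun_prop
  have h1 := DFunLike.congr_fun h (hc.toSchwartzMap hs)
  rw [TemperedDistribution.laplacian_apply_apply, Lp.toTemperedDistribution_apply,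
    Lp.toTemperedDistribution_apply] at h1
  have h2 := integral_mul_laplacian (hs.of_le (by norm_cast)) hc hf
  have h3 : ∫ x, (Δ (hc.toSchwartzMap hs) : 𝓢(E, ℂ)) x • u x
      = ∫ x, Δ (Complex.ofRealCLM ∘ φ) x * f x := by
    refine integral_congr_ae ?_
    filter_upwards [hu] with x hx
    rw [SchwartzMap.laplacian_apply, hx]
    rfl
  rw [h3, ← h2] at h1
  simpa using h1.symm

end ClassicalEquation

/-! ### Exponential decay by comparison with one-directional exponentials. -/

section ExponentialDecay

open Filter Topology

variable {E : Type*} [NormedAddCommGroup E] [InnerProductSpace ℝ E] [FiniteDimensional ℝ E]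
  [MeasurableSpace E] [BorelSpace E]

theorem norm_le_exp_neg_inner {f : E → ℂ} (hf : ContDiff ℝ 2 f)
    (hlim : Tendsto f (cocompact E) (𝓝 0)) {W : E → ℝ} (h : ∀ x, Δ f x = (W x : ℂ) * f x)
    {δ R M : ℝ} (hδ : 0 < δ) (hW : ∀ x, R < ‖x‖ → δ ^ 2 < W x) (hM : ∀ x, ‖f x‖ ≤ M)
    {e : E} (he : ‖e‖ = 1) (x₀ : E) :
    ‖f x₀‖ ≤ M * Real.exp (δ * R) * Real.exp (-δ * inner ℝ e x₀) := by
  -- This constant makes the barrier `w` at least `M ≥ |f|` on the ball of radius `R`, so a positive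
  -- maximum of `|f| - w` lies where `W > δ²`. The barrier need not decay: `f → 0` and `w ≥ 0`
  -- suffice for the maximum to exist.
  set C := M * Real.exp (δ * R) with hC
  set w : E → ℝ := fun x => C * Real.exp (-δ * inner ℝ e x) with hw
  have hM0 : 0 ≤ M := (norm_nonneg _).trans (hM 0)
  have hw0 : ∀ x, 0 ≤ w x := fun x => by positivity
  have hg : ContDiff ℝ 2 fun r : ℝ => C * Real.exp (-δ * r) := by fun_prop
  have hwd : ContDiff ℝ 2 w := hg.comp (contDiff_const.inner ℝ contDiff_id)
  have hΔw : ∀ x, Δ w x = δ ^ 2 * w x := fun x => by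
    have h1 : deriv (fun r : ℝ => C * Real.exp (-δ * r)) =
        fun r => (-δ * C) * Real.exp (-δ * r) := by
      funext r
      have := (((hasDerivAt_id r).const_mul (-δ)).exp.const_mul C).deriv
      simp only [id] at this
      rw [this]
      ring
    have h2 : ∀ r, deriv (fun r : ℝ => (-δ * C) * Real.exp (-δ * r)) r =
        δ ^ 2 * (C * Real.exp (-δ * r)) := by
      intro r
      have := (((hasDerivAt_id r).const_mul (-δ)).exp.const_mul (-δ * C)).deriv
      simp only [id] at this
      rw [this]
      ring
    rw [hw, laplacian_comp_inner hg, he, h1, h2]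
    ring
  by_contra! hx₀
  have hpos : 0 < ‖f x₀‖ - w x₀ := sub_pos.mpr hx₀
  obtain ⟨x, -, hxx₀, hx⟩ := exists_isMaxOn_of_eventually_cocompact (x₀ := x₀) isClosed_univ
    (hf.continuous.norm.sub hwd.continuous) (Set.mem_univ _) (by
      rw [principal_univ, inf_top_eq]
      have h0 : Tendsto (fun x => ‖f x‖) (cocompact E) (𝓝 0) := by simpa using hlim.norm
      filter_upwards [h0.eventually_le_const hpos] with x h1
      exact (sub_le_self _ (hw0 x)).trans h1)
  have hxpos : 0 < ‖f x‖ - w x := hpos.trans_le hxx₀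
  have hxR : R < ‖x‖ := by
    by_contra! hle
    have h1 : inner ℝ e x ≤ R := (real_inner_le_norm e x).trans (by rwa [he, one_mul])
    have h2 : M ≤ w x := by
      simp only [hw, hC]
      rw [mul_assoc, ← Real.exp_add]
      exact le_mul_of_one_le_right hM0 (Real.one_le_exp (by nlinarith))
    linarith [hM x]
  -- Since `|f|` may fail to be smooth, it is replaced by `re (c f)`, which lies below `|f|` and
  -- touches it at `x`. There the Laplacian of `re (c f) - w` is `W |f| - δ² w > 0`, contradicting
  -- maximality.
  obtain ⟨c, hc, hcf⟩ := RCLike.exists_norm_eq_mul_self (f x)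
  have hcx : (c * f x).re = ‖f x‖ := by
    rw [← hcf]
    simp
  have hcd : ContDiff ℝ 2 fun y => (c * f y).re :=
    (Complex.reCLM ∘L (ContinuousLinearMap.mul ℝ ℂ c)).contDiff.comp hf
  have hmax : IsLocalMax (fun y => (c * f y).re - w y) x := by
    refine Eventually.of_forall fun y => ?_
    have h1 := (le_abs_self _).trans (re_mul_le_norm_of_norm_eq_one (z := f y) hc)
    simp only [hcx]
    have h2 : ‖f y‖ - w y ≤ ‖f x‖ - w x := hx y (Set.mem_univ _)
    linarith
  have hΔ := hmax.laplacian_nonpos (hcd.sub hwd)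
  have hsub : Δ (fun y => (c * f y).re - w y) x = W x * ‖f x‖ - δ ^ 2 * w x := by
    have h1 := hcd.contDiffAt.laplacian_sub (x := x) hwd.contDiffAt
    have h2 : (c * ((W x : ℂ) * f x)).re = W x * ‖f x‖ := by
      rw [mul_left_comm, Complex.re_ofReal_mul, hcx]
    rw [← h2, ← h x, ← laplacian_re_mul hf, ← hΔw]
    exact h1
  rw [hsub] at hΔ
  have h1 := hW x hxR
  have h2 : 0 < ‖f x‖ := by linarith [hw0 x]
  nlinarith [hw0 x, sq_nonneg δ]

/-- Agmon-type decay: solutions of `Δ f = W f` that vanish at infinity decay exponentially at every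
rate `δ` with `δ² < lim inf W`. -/
theorem exists_exp_mul_norm_le {f : E → ℂ} (hf : ContDiff ℝ 2 f)
    (hlim : Tendsto f (cocompact E) (𝓝 0)) {W : E → ℝ} (h : ∀ x, Δ f x = (W x : ℂ) * f x)
    {δ : ℝ} (hδ : 0 < δ) (hW : ∀ᶠ x in cocompact E, δ ^ 2 < W x) :
    ∃ C, ∀ x, Real.exp (δ * ‖x‖) * ‖f x‖ ≤ C := by
  obtain ⟨M, hM⟩ := exists_norm_le_of_tendsto_cocompact hf.continuous hlim
  obtain ⟨K, hK, hKW⟩ := mem_cocompact.mp hW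
  obtain ⟨R, hR⟩ := hK.isBounded.subset_closedBall 0
  have hRW : ∀ x, R < ‖x‖ → δ ^ 2 < W x := fun x hx => hKW fun hxK => by
    have := hR hxK
    rw [mem_closedBall_zero_iff] at this
    linarith
  have hM0 : 0 ≤ M := (norm_nonneg _).trans (hM 0)
  refine ⟨max M (M * Real.exp (δ * R)), fun x => ?_⟩
  rcases eq_or_ne x 0 with rfl | hx
  · simpa using Or.inl (hM 0)
  refine le_max_of_le_right ?_
  have hx' : ‖x‖ ≠ 0 := norm_ne_zero_iff.mpr hx
  -- The constant does not depend on the direction, so `e` may be chosen along `x`, turning `⟨e, x⟩`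
  -- into `|x|`.
  have h1 := norm_le_exp_neg_inner hf hlim h hδ hRW hM (e := ‖x‖⁻¹ • x)
    (by rw [norm_smul, norm_inv, norm_norm, inv_mul_cancel₀ hx']) x
  have h2 : inner ℝ (‖x‖⁻¹ • x) x = ‖x‖ := by
    rw [real_inner_smul_left, real_inner_self_eq_norm_sq]
    field_simp
  rw [h2] at h1
  calc _ ≤ Real.exp (δ * ‖x‖) * (M * Real.exp (δ * R) * Real.exp (-δ * ‖x‖)) := by gcongr
    _ = M * Real.exp (δ * R) * Real.exp (δ * ‖x‖ + -δ * ‖x‖) := by rw [Real.exp_add]; ring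
    _ = _ := by simp

end ExponentialDecay

/-! ### Application to the solitary wave equation. -/

section SolitaryWave

open Filter Topology

theorem contDiff_saturation (ω : ℝ) : ContDiff ℝ (⊤ : ℕ∞) fun z : ℂ =>
    ((1 + ((2 * Real.pi) ^ 2)⁻¹ * (‖z‖ ^ 2 / (1 + ‖z‖ ^ 2) - ω) : ℝ) : ℂ) := by
  have h1 : ContDiff ℝ (⊤ : ℕ∞) fun z : ℂ => ‖z‖ ^ 2 := contDiff_norm_sq ℝ
  have h2 : ContDiff ℝ (⊤ : ℕ∞) fun z : ℂ => ‖z‖ ^ 2 / (1 + ‖z‖ ^ 2) :=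
    h1.div (contDiff_const.add h1) fun z => by positivity
  exact Complex.ofRealCLM.contDiff.comp
    (contDiff_const.add (contDiff_const.mul (h2.sub contDiff_const)))

namespace IsSolitaryWave

variable {d : ℕ} {ω : ℝ} {U : Lp ℂ 2 (volume : Measure (EuclideanSpace ℝ (Fin d)))}

theorem laplacian_eq (hU : IsSolitaryWave 1 ω U) :
    Δ (U : 𝓢'(EuclideanSpace ℝ (Fin d), ℂ)) =
      (((ω : ℂ) • U - saturatedTerm U : Lp ℂ 2 (volume : Measure (EuclideanSpace ℝ (Fin d)))) :
        𝓢'(EuclideanSpace ℝ (Fin d), ℂ)) := by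
  have h := hU.equation
  rw [Complex.ofReal_one, one_smul] at h
  rw [← Lp.toTemperedDistributionCLM_apply ((ω : ℂ) • U - saturatedTerm U), map_sub, map_smul,
    Lp.toTemperedDistributionCLM_apply, Lp.toTemperedDistributionCLM_apply, ← h]
  abel

/-- The right-hand side of the equation written as `U - (2π)⁻² Δ U = g`. -/
theorem exists_eq_besselPotential (hU : IsSolitaryWave 1 ω U) :
    ∃ g : Lp ℂ 2 (volume : Measure (EuclideanSpace ℝ (Fin d))),
      (U : 𝓢'(EuclideanSpace ℝ (Fin d), ℂ)) =
        besselPotential (EuclideanSpace ℝ (Fin d)) ℂ (-2) g ∧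
      ∀ᵐ x, ((1 + ((2 * Real.pi) ^ 2)⁻¹ * (‖U x‖ ^ 2 / (1 + ‖U x‖ ^ 2) - ω) : ℝ) : ℂ) * U x
        = g x := by
  set c : ℝ := ((2 * Real.pi) ^ 2)⁻¹ with hc
  set k : Lp ℂ 2 (volume : Measure (EuclideanSpace ℝ (Fin d))) :=
    (ω : ℂ) • U - saturatedTerm U with hk
  refine ⟨U - (c : ℂ) • k, ?_, ?_⟩
  · have h1 := besselPotential_two_eq (U : 𝓢'(EuclideanSpace ℝ (Fin d), ℂ))
    rw [hU.laplacian_eq] at h1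
    have h2 : ((U - (c : ℂ) • k : Lp ℂ 2 (volume : Measure (EuclideanSpace ℝ (Fin d)))) :
        𝓢'(EuclideanSpace ℝ (Fin d), ℂ)) = besselPotential (EuclideanSpace ℝ (Fin d)) ℂ 2 U := by
      rw [h1, ← Lp.toTemperedDistributionCLM_apply, map_sub, map_smul]
      rfl
    rw [h2, besselPotential_besselPotential_apply]
    simp
  · filter_upwards [Lp.coeFn_sub U ((c : ℂ) • k), Lp.coeFn_smul (c : ℂ) k,
      Lp.coeFn_sub ((ω : ℂ) • U) (saturatedTerm U), Lp.coeFn_smul (ω : ℂ) U,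
      (memLp_saturatedNonlinearity U).coeFn_toLp] with x h1 h2 h3 h4 h5
    have h5' : saturatedTerm U x = saturatedNonlinearity (U x) := h5
    rw [h1, Pi.sub_apply, h2, Pi.smul_apply, hk, h3, Pi.sub_apply, h4, Pi.smul_apply, h5',
      saturatedNonlinearity, Complex.real_smul, smul_eq_mul, smul_eq_mul]
    push_cast
    ring

theorem ae_bound (hU : IsSolitaryWave 1 ω U) : ∃ M, ∀ᵐ x, ‖U x‖ ≤ M := by
  obtain ⟨g, hg, hgU⟩ := hU.exists_eq_besselPotential
  refine ae_bound_of_norm_le_mul (C := 1 + ((2 * Real.pi) ^ 2)⁻¹ * (1 + |ω|)) hg (by positivity) ?_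
  filter_upwards [hgU] with x hx
  rw [← hx, norm_mul, Complex.norm_real]
  gcongr
  have h0 : (0 : ℝ) ≤ ‖U x‖ ^ 2 / (1 + ‖U x‖ ^ 2) := by positivity
  have h1 : ‖U x‖ ^ 2 / (1 + ‖U x‖ ^ 2) ≤ 1 := by
    rw [div_le_one (by positivity)]
    linarith
  refine (norm_add_le _ _).trans ?_
  rw [norm_one, norm_mul, Real.norm_of_nonneg (by positivity : 0 ≤ ((2 * Real.pi) ^ 2)⁻¹)]
  gcongr
  refine (norm_sub_le _ _).trans ?_
  rw [Real.norm_of_nonneg h0, Real.norm_eq_abs]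
  gcongr

theorem bddSobolev (hU : IsSolitaryWave 1 ω U) (k : ℕ) : BddSobolev k U := by
  obtain ⟨g, hg, hgU⟩ := hU.exists_eq_besselPotential
  induction k with
  | zero => exact ⟨Lp.memLp U, hU.ae_bound⟩
  | succ k ih =>
    -- Bootstrap: `g = F(U) U` has the regularity of `U`, and inverting the operator gains one
    -- order.
    exact BddSobolev.of_eq_besselPotential hg ((ih.comp_mul (contDiff_saturation ω) ih).congr hgU)

theorem memHInfty (hU : IsSolitaryWave 1 ω U) :
    MemHInfty (U : 𝓢'(EuclideanSpace ℝ (Fin d), ℂ)) := by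
  intro s
  have h := (hU.bddSobolev ⌈s⌉₊).memSobolev (Lp.memLp U)
  rw [Lp.toLp_coeFn] at h
  exact h.mono (Nat.le_ceil s)

theorem exists_classical (hU : IsSolitaryWave 1 ω U) :
    ∃ f : EuclideanSpace ℝ (Fin d) → ℂ, ContDiff ℝ 2 f ∧ Tendsto f (cocompact _) (𝓝 0) ∧
      U =ᵐ[volume] f ∧ ∀ x, Δ f x = ((ω - ‖f x‖ ^ 2 / (1 + ‖f x‖ ^ 2) : ℝ) : ℂ) * f x := by
  obtain ⟨f, hf, hlim, hUf⟩ := exists_contDiff_two_of_memSobolev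
    (s := Module.finrank ℝ (EuclideanSpace ℝ (Fin d)) + 1)
    (by have : (0 : ℝ) ≤ Module.finrank ℝ (EuclideanSpace ℝ (Fin d)) := Nat.cast_nonneg _
        linarith) (hU.memHInfty _)
  refine ⟨f, hf, hlim, hUf, fun x => ?_⟩
  have h1 := laplacian_ae_eq_of_toTemperedDistribution hU.laplacian_eq hf hUf
  have h2 : Δ f =ᵐ[volume] fun x => ω * f x - saturatedNonlinearity (f x) := by
    filter_upwards [h1, hUf, Lp.coeFn_sub ((ω : ℂ) • U) (saturatedTerm U),
      Lp.coeFn_smul (ω : ℂ) U, (memLp_saturatedNonlinearity U).coeFn_toLp] with x h1 h2 h3 h4 h5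
    have h5' : saturatedTerm U x = saturatedNonlinearity (U x) := h5
    rw [← h1, h3, Pi.sub_apply, h4, Pi.smul_apply, h5', h2, smul_eq_mul]
  -- Both sides are continuous, so equality almost everywhere is equality everywhere.
  have h3 := congrFun ((hf.continuous_laplacian.ae_eq_iff_eq volume
    ((continuous_const.mul hf.continuous).sub
      (continuous_saturatedNonlinearity.comp hf.continuous))).mp h2) x
  have h4 : Δ f x = ω * f x - saturatedNonlinearity (f x) := h3
  rw [h4, saturatedNonlinearity, Complex.real_smul]
  push_cast
  ring

theorem memLp_top_exp_smul (hω₀ : 0 < ω) (hω₁ : ω < 1) (hU : IsSolitaryWave 1 ω U) {δ : ℝ}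
    (hδ : δ < ω / 2) :
    MemLp (fun x : EuclideanSpace ℝ (Fin d) => Real.exp (δ * ‖x‖) • U x) ∞ volume := by
  have hmeas : AEStronglyMeasurable
      (fun x : EuclideanSpace ℝ (Fin d) => Real.exp (δ * ‖x‖) • U x) volume :=
    (by fun_prop : Continuous fun x : EuclideanSpace ℝ (Fin d) =>
      Real.exp (δ * ‖x‖)).aestronglyMeasurable.smul (Lp.aestronglyMeasurable U)
  suffices h : ∃ C, ∀ᵐ x : EuclideanSpace ℝ (Fin d), Real.exp (δ * ‖x‖) * ‖U x‖ ≤ C by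
    obtain ⟨C, hC⟩ := h
    refine memLp_top_of_bound hmeas C ?_
    filter_upwards [hC] with x hx
    rwa [norm_smul, Real.norm_of_nonneg (Real.exp_pos _).le]
  rcases le_or_gt δ 0 with hδ0 | hδ0
  · obtain ⟨M, hM⟩ := hU.ae_bound
    refine ⟨M, ?_⟩
    filter_upwards [hM] with x hx
    refine (mul_le_of_le_one_left (norm_nonneg _) ?_).trans hx
    exact Real.exp_le_one_iff.mpr (mul_nonpos_of_nonpos_of_nonneg hδ0 (norm_nonneg x))
  · obtain ⟨f, hf, hlim, hUf, heq⟩ := hU.exists_classical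
    have hV : Tendsto (fun x => ω - ‖f x‖ ^ 2 / (1 + ‖f x‖ ^ 2)) (cocompact _) (𝓝 ω) := by
      have h1 : Tendsto (fun x => ‖f x‖ ^ 2) (cocompact _) (𝓝 0) := by
        simpa using hlim.norm.pow 2
      simpa using (h1.div (h1.const_add 1) (by norm_num)).const_sub ω
    -- The rate is admissible because `0 < δ < ω/2` and `ω < 1` give `δ² < ω²/4 < ω`.
    obtain ⟨C, hC⟩ := exists_exp_mul_norm_le hf hlim heq hδ0
      (hV.eventually_const_lt (by nlinarith))
    refine ⟨C, ?_⟩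
    filter_upwards [hUf] with x hx
    rw [hx]
    exact hC x

end IsSolitaryWave

end SolitaryWave

theorem proposition5 (d : ℕ) (hd : 1 ≤ d) (ω : ℝ) (hω₀ : 0 < ω) (hω₁ : ω < 1)
    (U : Lp ℂ 2 (volume : Measure (EuclideanSpace ℝ (Fin d))))
    (hU : IsSolitaryWave 1 ω U) :
    MemHInfty (U : 𝓢'(EuclideanSpace ℝ (Fin d), ℂ)) ∧
      ∀ δ : ℝ, δ < ω / 2 →
        MemLp (fun x : EuclideanSpace ℝ (Fin d) => Real.exp (δ * ‖x‖) • U x) ∞ volume :=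
  ⟨hU.memHInfty, fun _ hδ => hU.memLp_top_exp_smul hω₀ hω₁ hδ⟩
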